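/- Let $\mathbb T^2=\mathbb R^2/\mathbb Z^2$, identified with $[-\frac12,\frac12]^2$ with periodic boundary conditions and equipped with Lebesgue measure. Let $G$ be the Green function on $\mathbb T^2$, i.e. the integrable function (unique up to null sets; its existence is part of the claim) with $\int_{\mathbb T^2}G\,dx=0$ and $-\Delta G=\delta_0-1$ in the sense of distributions on $\mathbb T^2$. Its distributional partial derivatives $\partial_1G,\partial_2G$ are integrable functions. For a function $f$ with compact support in $(-\frac12,\frac12)^2$ and $\ell\in(0,1)$, let $f_\ell(x)=\ell^{-2}f(\ell^{-1}x)$, $x\in\mathbb T^2$. Convolutions are taken on $\mathbb T^2$, $(\partial_iG\ast f)(x)=\int_{\mathbb T^2}\partial_iG(x-y)f(y)\,dy$, and $\langle\cdot,\cdot\rangle$ is the inner product of $L^2(\mathbb T^2)$. (i) Let $\phi,\psi\in C_c\big((-\frac12,\frac12)^2\big)$ be radially symmetric probability density functions. Then for all $i,j\in\{1,2\}$, $$\lim_{\ell\to0^+}\frac{\langle\partial_iG\ast\phi_\ell,\ \partial_jG\ast\psi_\ell\rangle}{\log\ell^{-1}}=\frac1{4\pi}\,\delta_{i,j},$$ where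 $\delta_{i,j}$ is Kronecker's delta. (ii) Consequently, let $K=\nabla^\perp G=(\partial_2G,-\partial_1G)$ be the Biot–Savart kernel on $\mathbb T^2$, let $\theta\in C_c\big((-\frac12,\frac12)^2\big)$ be a radially symmetric probability density function, let $\kappa>0$, and put $\Gamma_\ell=2\sqrt\kappa\,\|K\ast\theta_\ell\|_{L^2(\mathbb T^2;\mathbb R^2)}^{-1}$. Then $$\lim_{\ell\to0^+}\Gamma_\ell^2\,\log\ell^{-1}=8\pi\kappa.$$ -/

import Mathlib

open MeasureTheory Filter Topology
open scoped ContDiff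

noncomputable section

namespace TorusVortex

/-- The plane `ℝ²` with the Euclidean norm. -/
abbrev Plane : Type := EuclideanSpace ℝ (Fin 2)

/-- The torus `𝕋² = ℝ² / ℤ²`. -/
abbrev T2 : Type := UnitAddTorus (Fin 2)

/-- Lebesgue measure on `𝕋²`, of total mass one. -/
abbrev torusMeasure : Measure T2 := Measure.pi fun _ => AddCircle.haarAddCircle

/-- The representative in `(-1/2, 1/2]²` of a point of `𝕋²`. -/
def rep (x : T2) : Plane :=
  WithLp.toLp 2 fun i => (AddCircle.equivIoc (1 : ℝ) (-1 / 2) (x i) : ℝ)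

/-- `f : 𝕋² → ℝ` is smooth: the corresponding periodic function on `ℝ²` is `C^∞`. -/
def IsSmooth (f : T2 → ℝ) : Prop :=
  ContDiff ℝ ∞ fun x : Plane => f fun i => (x i : UnitAddCircle)

/-- The classical partial derivative `∂ᵢ f` on `𝕋²` (used for smooth `f`). -/
def partialDeriv (i : Fin 2) (f : T2 → ℝ) (x : T2) : ℝ :=
  deriv (fun t : ℝ => f (x + Pi.single i (t : UnitAddCircle))) 0

/-- The Laplacian on `𝕋²` (used for smooth `f`). -/
def laplacian (f : T2 → ℝ) (x : T2) : ℝ :=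
  ∑ i, partialDeriv i (partialDeriv i f) x

/-- `G` is the Green function on `𝕋²`: it has zero mean and `-Δ G = δ₀ - 1` in the sense of
distributions. -/
structure IsGreenFunction (G : T2 → ℝ) : Prop where
  integrable : Integrable G torusMeasure
  mean_zero : ∫ x, G x ∂torusMeasure = 0
  neg_laplacian : ∀ f : T2 → ℝ, IsSmooth f →
    ∫ x, G x * (-laplacian f x) ∂torusMeasure = f 0 - ∫ x, f x ∂torusMeasure

/-- The integrable function `H` is the distributional derivative `∂ᵢ G` on `𝕋²`. -/
structure IsWeakPartialDeriv (i : Fin 2) (G H : T2 → ℝ) : Prop where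
  integrable : Integrable H torusMeasure
  integral_eq : ∀ f : T2 → ℝ, IsSmooth f →
    ∫ x, G x * partialDeriv i f x ∂torusMeasure = -∫ x, H x * f x ∂torusMeasure

/-- `φ ∈ C_c((-1/2, 1/2)²)`, extended by zero to `ℝ²`, is a radially symmetric probability
density. -/
structure IsRadialDensity (φ : Plane → ℝ) : Prop where
  continuous : Continuous φ
  hasCompactSupport : HasCompactSupport φ
  tsupport_subset : tsupport φ ⊆ {x | ∀ i, x i ∈ Set.Ioo (-1 / 2 : ℝ) (1 / 2)}
  nonneg : ∀ x, 0 ≤ φ x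
  integral_eq_one : ∫ x, φ x = 1
  radial : ∀ x y, ‖x‖ = ‖y‖ → φ x = φ y

/-- `φ_ℓ(x) = ℓ⁻² φ(ℓ⁻¹ x)` as a function on `𝕋²`, identified with `(-1/2, 1/2]²`. -/
def rescale (φ : Plane → ℝ) (ℓ : ℝ) (x : T2) : ℝ :=
  (ℓ ^ 2)⁻¹ * φ (ℓ⁻¹ • rep x)

/-- `(F ∗ g)(x) = ∫ F(x - y) g(y) dy` on `𝕋²`, for scalar or vector valued `F`. -/
def conv {E : Type*} [NormedAddCommGroup E] [NormedSpace ℝ E] (F : T2 → E) (g : T2 → ℝ) : T2 → E :=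
  convolution g F (ContinuousLinearMap.lsmul ℝ ℝ) torusMeasure

/-- The pairing `⟨f, g⟩` of `L²(𝕋²)`. -/
def pairing (f g : T2 → ℝ) : ℝ := ∫ x, f x * g x ∂torusMeasure

/-- The `L²(𝕋²; ℝ²)` norm of a vector field. -/
def l2Norm (u : T2 → Plane) : ℝ := √(∫ x, ‖u x‖ ^ 2 ∂torusMeasure)

/-- The Biot–Savart kernel `K = ∇^⊥ G = (∂₂ G, -∂₁ G)` on `𝕋²`, where `DG` is the gradient
of the Green function. -/
def biotSavart (DG : Fin 2 → T2 → ℝ) (x : T2) : Plane := !₂[DG 1 x, -DG 0 x]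

/-- The vortex intensity `Γ_ℓ = 2 √κ ‖K ∗ θ_ℓ‖_{L²}⁻¹`. -/
def intensity (DG : Fin 2 → T2 → ℝ) (κ : ℝ) (θ : Plane → ℝ) (ℓ : ℝ) : ℝ :=
  2 * √κ * (l2Norm (conv (biotSavart DG) (rescale θ ℓ)))⁻¹

end TorusVortex

end

noncomputable section

namespace TorusVortex

open UnitAddTorus
open scoped ComplexConjugate

/-! Everything is computed in Fourier series. Testing the defining equations against characters
gives `∂ᵢG` the coefficients `i kᵢ / (2π|k|²)` (`IsWeakPartialDeriv.coeff_eq`). For a radial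
density, `φ_ℓ` has coefficients `φ̂(ℓk)`, real and invariant under the symmetries of the lattice
(`coeff_rescale`). By Parseval the pairing is therefore `∑ kᵢkⱼ / (4π²|k|⁴) · φ̂(ℓk) ψ̂(ℓk)`
(`hasSum_pairing_conv`).

For `i ≠ j` the reflection `k₀ ↦ -k₀` makes the sum cancel. For `i = j`, averaging over the swap of
coordinates replaces `kᵢ²` by `|k|²/2` and leaves `(8π²)⁻¹ ∑ |k|⁻² φ̂(ℓk) ψ̂(ℓk)`. The product of
transforms is `1 + O(ℓ²|k|²)` on the box `|k|_∞ ≤ 1/ℓ`. Outside the box Parseval gives `∑ φ̂(ℓk)² =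
O(ℓ⁻²)`, so the tail is bounded. Since the box sum of `|k|⁻²` is `2π log N + O(1)`
(`abs_boxSum_sub_log_le`), the lattice sum is `2π log ℓ⁻¹ + O(1)` (`exists_abs_tsum_sub_log_le`),
and `2π / 8π² = 1/(4π)`. For (ii), `‖K ∗ θ_ℓ‖²` is the sum of the two diagonal pairings.

Existence of `G` in `L²` is Riesz–Fischer. The coefficients of `∂ᵢG` are not square summable, so an
integrable representative is built from dyadic blocks in `k₁`. Each block is in `L²`, and its `L¹`
norm decays geometrically because increments of the coefficients are of order `|k|⁻²`
(`integral_norm_le_of_coeff`, `tsum_blockCoeff_increment_le`). -/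

/-! ### Fourier series on the torus: Parseval, Riesz–Fischer, inversion. -/

/-- Fourier coefficients on the torus. -/
def coeff (f : T2 → ℂ) (k : Fin 2 → ℤ) : ℂ := ∫ x, mFourier (-k) x * f x ∂torusMeasure

lemma norm_mFourier_apply (k : Fin 2 → ℤ) (x : T2) : ‖mFourier k x‖ = 1 := by
  simp only [mFourier, fourier_apply, ContinuousMap.coe_mk, norm_prod, Circle.norm_coe,
    Finset.prod_const_one]

lemma coeff_eq_mFourierCoeff (f : T2 → ℂ) (k : Fin 2 → ℤ) : coeff f k = mFourierCoeff f k := rfl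

lemma coeff_congr_ae {f g : T2 → ℂ} (h : f =ᵐ[torusMeasure] g) (k : Fin 2 → ℤ) :
    coeff f k = coeff g k :=
  integral_congr_ae (by filter_upwards [h] with x hx; rw [hx])

/-- Parseval's identity. -/
lemma hasSum_conj_coeff_mul_coeff {f g : T2 → ℂ} (hf : MemLp f 2 torusMeasure)
    (hg : MemLp g 2 torusMeasure) :
    HasSum (fun k => conj (coeff f k) * coeff g k) (∫ x, conj (f x) * g x ∂torusMeasure) := by
  have h := hasSum_prod_mFourierCoeff (hf.toLp f) (hg.toLp g)
  have e1 : ∀ k, mFourierCoeff (hf.toLp f : T2 → ℂ) k = coeff f k := fun k =>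
    coeff_congr_ae hf.coeFn_toLp k
  have e2 : ∀ k, mFourierCoeff (hg.toLp g : T2 → ℂ) k = coeff g k := fun k =>
    coeff_congr_ae hg.coeFn_toLp k
  simp only [e1, e2] at h
  convert h using 1
  refine integral_congr_ae ?_
  filter_upwards [hf.coeFn_toLp, hg.coeFn_toLp] with x h1 h2
  rw [h1, h2]

lemma hasSum_sq_norm_coeff {f : T2 → ℂ} (hf : MemLp f 2 torusMeasure) :
    HasSum (fun k => ‖coeff f k‖ ^ 2) (∫ x, ‖f x‖ ^ 2 ∂torusMeasure) := by
  have h := hasSum_conj_coeff_mul_coeff hf hf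
  have e (z : ℂ) : conj z * z = ((‖z‖ ^ 2 : ℝ) : ℂ) := by
    rw [mul_comm, Complex.mul_conj, Complex.normSq_eq_norm_sq]
  simp only [e] at h
  rw [integral_complex_ofReal] at h
  exact_mod_cast h

/-- The Riesz–Fischer theorem. -/
lemma exists_memLp_coeff_eq {a : (Fin 2 → ℤ) → ℂ} (ha : Summable fun k => ‖a k‖ ^ 2) :
    ∃ f : T2 → ℂ, MemLp f 2 torusMeasure ∧ ∀ k, coeff f k = a k := by
  have hm : Memℓp a 2 := by
    rw [memℓp_gen_iff (by norm_num)]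
    simpa using ha
  let A : lp (fun _ : Fin 2 → ℤ => ℂ) 2 := ⟨a, hm⟩
  let F := (mFourierBasis (d := Fin 2)).repr.symm A
  refine ⟨F, Lp.memLp F, fun k => ?_⟩
  have := mFourierBasis_repr F k
  rw [coeff_eq_mFourierCoeff, ← this]
  simp [F, A]

lemma hasSum_coeff_mul_mFourier {f : T2 → ℂ} (hf : Continuous f) (h : Summable (coeff f)) (x : T2) :
    HasSum (fun k => coeff f k * mFourier k x) (f x) :=
  hasSum_mFourier_series_apply_of_summable (f := ⟨f, hf⟩) h x

/-- Characters have modulus one, so they are bounded multipliers of `L¹`. -/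
lemma integrable_mFourier_mul {g : T2 → ℂ} (hg : Integrable g torusMeasure) (k : Fin 2 → ℤ) :
    Integrable (fun x => mFourier k x * g x) torusMeasure :=
  hg.bdd_mul (c := 1) (mFourier k).continuous.aestronglyMeasurable
    (ae_of_all _ fun x => (norm_mFourier_apply k x).le)

/-- Parseval when `g` is only integrable: absolute summability of the coefficients of `f` allows
integrating its Fourier series against `g` term by term. -/
lemma hasSum_coeff_mul_coeff_neg {f g : T2 → ℂ} (hf : Continuous f) (h : Summable (coeff f))
    (hg : Integrable g torusMeasure) :
    HasSum (fun k => coeff f k * coeff g (-k)) (∫ x, g x * f x ∂torusMeasure) := by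
  have key := hasSum_integral_of_summable_integral_norm (μ := torusMeasure)
    (F := fun k x => coeff f k * (mFourier k x * g x))
    (fun k => (integrable_mFourier_mul hg k).const_mul _) (by
      simp only [norm_mul, norm_mFourier_apply, one_mul, integral_const_mul]
      exact h.norm.mul_right _)
  convert! key using 1
  · funext k
    simp [coeff, integral_const_mul]
  · refine integral_congr_ae (ae_of_all _ fun x => ?_)
    have := (hasSum_coeff_mul_mFourier hf h x).mul_left (g x)
    simp only
    rw [← this.tsum_eq]
    exact tsum_congr fun k => by ring

lemma norm_coeff_le (f : T2 → ℂ) (k : Fin 2 → ℤ) :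
    ‖coeff f k‖ ≤ ∫ x, ‖f x‖ ∂torusMeasure := by
  refine (norm_integral_le_integral_norm _).trans_eq ?_
  simp [norm_mFourier_apply]

/-! ### Calculus of smooth functions and characters on the torus. -/

/-- The quotient map `ℝ² → 𝕋²`. -/
def toTorus (x : Plane) : T2 := fun i => (x i : UnitAddCircle)

lemma toTorus_surjective : Function.Surjective toTorus := fun y => by
  choose p hp using fun i => QuotientAddGroup.mk_surjective (y i)
  exact ⟨WithLp.toLp 2 p, funext hp⟩

lemma isOpenQuotientMap_toTorus : IsOpenQuotientMap toTorus := by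
  have h : IsOpenQuotientMap (Pi.map fun (_ : Fin 2) (t : ℝ) => (t : UnitAddCircle)) :=
    IsOpenQuotientMap.piMap fun _ => QuotientAddGroup.isOpenQuotientMap_mk
  exact h.comp (PiLp.homeomorph 2 (fun _ : Fin 2 => ℝ)).isOpenQuotientMap

lemma toTorus_add_single (p : Plane) (i : Fin 2) (t : ℝ) :
    toTorus (p + t • EuclideanSpace.single i 1) = toTorus p + Pi.single i (t : UnitAddCircle) := by
  funext j
  by_cases h : j = i
  · subst h; simp [toTorus]
  · simp [toTorus, h]

lemma IsSmooth.continuous {f : T2 → ℝ} (hf : IsSmooth f) : Continuous f :=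
  isOpenQuotientMap_toTorus.isQuotientMap.continuous_iff.2 (ContDiff.continuous hf)

lemma IsSmooth.contDiff {f : T2 → ℝ} (hf : IsSmooth f) : ContDiff ℝ ∞ (f ∘ toTorus) := hf

lemma IsSmooth.hasDerivAt_toTorus {f : T2 → ℝ} (hf : IsSmooth f) (i : Fin 2) (p : Plane) :
    HasDerivAt (fun t : ℝ => f (toTorus p + Pi.single i (t : UnitAddCircle)))
      (fderiv ℝ (f ∘ toTorus) p (EuclideanSpace.single i 1)) 0 := by
  have h1 : HasFDerivAt (f ∘ toTorus) (fderiv ℝ (f ∘ toTorus) p) p :=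
    (hf.contDiff.differentiable (by simp) p).hasFDerivAt
  have := h1.hasLineDerivAt (EuclideanSpace.single i (1 : ℝ))
  simpa [HasLineDerivAt, toTorus_add_single] using this

lemma IsSmooth.partialDeriv_toTorus {f : T2 → ℝ} (hf : IsSmooth f) (i : Fin 2) (p : Plane) :
    partialDeriv i f (toTorus p) =
      fderiv ℝ (f ∘ toTorus) p (EuclideanSpace.single i 1) :=
  (hf.hasDerivAt_toTorus i p).deriv

lemma IsSmooth.partialDeriv {f : T2 → ℝ} (hf : IsSmooth f) (i : Fin 2) :
    IsSmooth (partialDeriv i f) := by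
  have h : ContDiff ℝ ∞ fun p => fderiv ℝ (f ∘ toTorus) p (EuclideanSpace.single i (1 : ℝ)) :=
    (hf.contDiff.fderiv_right (m := ∞) (by simp)).clm_apply contDiff_const
  rw [← funext (hf.partialDeriv_toTorus i)] at h
  exact h

lemma IsSmooth.laplacian {f : T2 → ℝ} (hf : IsSmooth f) : IsSmooth (laplacian f) :=
  ContDiff.sum fun i _ => ((hf.partialDeriv i).partialDeriv i).contDiff

lemma IsSmooth.neg {f : T2 → ℝ} (hf : IsSmooth f) : IsSmooth fun x => -f x :=
  ContDiff.neg hf.contDiff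

lemma IsSmooth.hasDerivAt {f : T2 → ℝ} (hf : IsSmooth f) (i : Fin 2) (x : T2) (t : ℝ) :
    HasDerivAt (fun t : ℝ => f (x + Pi.single i (t : UnitAddCircle)))
      (TorusVortex.partialDeriv i f (x + Pi.single i (t : UnitAddCircle))) t := by
  obtain ⟨p, hp⟩ := toTorus_surjective (x + Pi.single i (t : UnitAddCircle))
  have h := hf.hasDerivAt_toTorus i p
  rw [← hf.partialDeriv_toTorus, hp] at h
  have h2 := HasDerivAt.comp (h := fun s : ℝ => s - t) t (by rwa [sub_self])
    ((hasDerivAt_id t).sub_const t)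
  rw [mul_one] at h2
  refine h2.congr_of_eventuallyEq (Eventually.of_forall fun s => ?_)
  simp only [Function.comp]
  rw [add_assoc, ← Pi.single_add, AddCircle.coe_sub, add_sub_cancel]

lemma mFourier_add_apply (k : Fin 2 → ℤ) (x y : T2) :
    mFourier k (x + y) = mFourier k x * mFourier k y := by
  simp only [mFourier, ContinuousMap.coe_mk, ← Finset.prod_mul_distrib, Pi.add_apply, fourier_apply,
    smul_add, AddCircle.toCircle_add, Circle.coe_mul]

lemma mFourier_single_coe (k : Fin 2 → ℤ) (i : Fin 2) (t : ℝ) :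
    mFourier k (Pi.single i (t : UnitAddCircle)) = Complex.exp (2 * Real.pi * Complex.I * k i * t) := by
  have : mFourier k (Pi.single i (t : UnitAddCircle)) = fourier (k i) (t : UnitAddCircle) := by
    fin_cases i <;> simp [mFourier]
  rw [this, fourier_coe_apply]
  simp

lemma mFourier_toTorus (k : Fin 2 → ℤ) (p : Plane) :
    mFourier k (toTorus p) = Complex.exp (2 * Real.pi * Complex.I * (k 0 * p 0 + k 1 * p 1)) := by
  simp only [mFourier, ContinuousMap.coe_mk, toTorus, fourier_coe_apply, Fin.prod_univ_two,
    ← Complex.exp_add]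
  congr 1
  simp; ring

lemma hasDerivAt_mFourier (k : Fin 2 → ℤ) (i : Fin 2) (x : T2) :
    HasDerivAt (fun t : ℝ => mFourier k (x + Pi.single i (t : UnitAddCircle)))
      (2 * Real.pi * Complex.I * k i * mFourier k x) 0 := by
  simp only [mFourier_add_apply, mFourier_single_coe]
  have h1 : HasDerivAt (fun t : ℝ => 2 * Real.pi * Complex.I * k i * (t : ℂ))
      (2 * Real.pi * Complex.I * k i * 1) 0 := (Complex.ofRealCLM.hasDerivAt (x := (0 : ℝ))).const_mul _
  have := (h1.cexp).const_mul (mFourier k x)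
  convert! this using 1
  simp; ring

lemma isSmooth_mFourier_re (k : Fin 2 → ℤ) : IsSmooth fun x => (mFourier k x).re := by
  have h : ContDiff ℝ ∞ fun p : Plane => (mFourier k (toTorus p)).re := by
    simp only [mFourier_toTorus]
    refine Complex.reCLM.contDiff.comp (ContDiff.cexp (contDiff_const.mul (ContDiff.add ?_ ?_))) <;>
    exact contDiff_const.mul (Complex.ofRealCLM.contDiff.comp (by fun_prop))
  exact h

lemma isSmooth_mFourier_im (k : Fin 2 → ℤ) : IsSmooth fun x => (mFourier k x).im := by
  have h : ContDiff ℝ ∞ fun p : Plane => (mFourier k (toTorus p)).im := by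
    simp only [mFourier_toTorus]
    refine Complex.imCLM.contDiff.comp (ContDiff.cexp (contDiff_const.mul (ContDiff.add ?_ ?_))) <;>
    exact contDiff_const.mul (Complex.ofRealCLM.contDiff.comp (by fun_prop))
  exact h

lemma partialDeriv_mFourier_re (k : Fin 2 → ℤ) (i : Fin 2) (x : T2) :
    partialDeriv i (fun x => (mFourier k x).re) x = -(2 * Real.pi * k i) * (mFourier k x).im := by
  have h := (Complex.reCLM.hasFDerivAt.comp_hasDerivAt 0 (hasDerivAt_mFourier k i x)).deriv
  refine (Eq.trans ?_ h).trans ?_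
  · rfl
  · simp

lemma partialDeriv_mFourier_im (k : Fin 2 → ℤ) (i : Fin 2) (x : T2) :
    partialDeriv i (fun x => (mFourier k x).im) x = 2 * Real.pi * k i * (mFourier k x).re := by
  have h := (Complex.imCLM.hasFDerivAt.comp_hasDerivAt 0 (hasDerivAt_mFourier k i x)).deriv
  refine (Eq.trans ?_ h).trans ?_
  · rfl
  · simp

lemma partialDeriv_const_mul {f : T2 → ℝ} (c : ℝ) (i : Fin 2) (x : T2) :
    partialDeriv i (fun x => c * f x) x = c * partialDeriv i f x :=
  deriv_const_mul_field c

/-- `|k|²`. -/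
def normSq (k : Fin 2 → ℤ) : ℝ := (k 0 : ℝ) ^ 2 + (k 1 : ℝ) ^ 2

lemma laplacian_mFourier_re (k : Fin 2 → ℤ) (x : T2) :
    laplacian (fun x => (mFourier k x).re) x = -(4 * Real.pi ^ 2 * normSq k) * (mFourier k x).re := by
  have e (i : Fin 2) : partialDeriv i (fun x => (mFourier k x).re) =
    fun x => -(2 * Real.pi * k i) * (mFourier k x).im := funext (partialDeriv_mFourier_re k i)
  simp only [laplacian, e, partialDeriv_const_mul, partialDeriv_mFourier_im, Fin.sum_univ_two, normSq]
  ring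

lemma laplacian_mFourier_im (k : Fin 2 → ℤ) (x : T2) :
    laplacian (fun x => (mFourier k x).im) x = -(4 * Real.pi ^ 2 * normSq k) * (mFourier k x).im := by
  have e (i : Fin 2) : partialDeriv i (fun x => (mFourier k x).im) =
    fun x => (2 * Real.pi * k i) * (mFourier k x).re := funext (partialDeriv_mFourier_im k i)
  simp only [laplacian, e, partialDeriv_const_mul, partialDeriv_mFourier_re, Fin.sum_univ_two, normSq]
  ring

/-- The Fourier coefficients of a partial derivative. -/
lemma IsSmooth.coeff_partialDeriv {f : T2 → ℝ} (hf : IsSmooth f) (i : Fin 2) (k : Fin 2 → ℤ) :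
    coeff (fun x => (TorusVortex.partialDeriv i f x : ℂ)) k =
      2 * Real.pi * Complex.I * k i * coeff (fun x => (f x : ℂ)) k := by
  have hc : Continuous fun x => TorusVortex.partialDeriv i f x := (hf.partialDeriv i).continuous
  obtain ⟨C, hC⟩ := (isCompact_range hc).isBounded.exists_norm_le
  -- Instead of integrating by parts, differentiate at `t = 0` the coefficient of the translate `f(·
  -- + t eᵢ)`: explicitly in `h2`, under the integral sign in `h3`.
  have h1 : ∀ t : ℝ, ∫ x, mFourier (-k) x * (f (x + Pi.single i (t : UnitAddCircle)) : ℂ) ∂torusMeasure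
      = Complex.exp (2 * Real.pi * Complex.I * k i * t) * coeff (fun x => (f x : ℂ)) k := fun t => by
    rw [coeff, ← integral_add_right_eq_self (fun x => mFourier (-k) x * (f x : ℂ))
      (Pi.single i (t : UnitAddCircle)), ← integral_const_mul]
    refine integral_congr_ae (ae_of_all _ fun x => ?_)
    simp only
    have e : Complex.exp (2 * Real.pi * Complex.I * k i * t) *
        Complex.exp (2 * Real.pi * Complex.I * ((-k) i : ℤ) * t) = 1 := by
      rw [← Complex.exp_add, Complex.exp_eq_one_iff]
      exact ⟨0, by simp⟩
    rw [mFourier_add_apply, mFourier_single_coe]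
    linear_combination (-mFourier (-k) x * f (x + Pi.single i (t : UnitAddCircle))) * e
  have h2 : HasDerivAt (fun t : ℝ => Complex.exp (2 * Real.pi * Complex.I * k i * t) *
      coeff (fun x => (f x : ℂ)) k) (2 * Real.pi * Complex.I * k i * coeff (fun x => (f x : ℂ)) k) 0 := by
    have h1 : HasDerivAt (fun t : ℝ => 2 * Real.pi * Complex.I * k i * (t : ℂ))
      (2 * Real.pi * Complex.I * k i * 1) 0 := (Complex.ofRealCLM.hasDerivAt (x := (0 : ℝ))).const_mul _
    have := (h1.cexp).mul_const (coeff (fun x => (f x : ℂ)) k)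
    convert! this using 1
    simp
  have h3 := hasDerivAt_integral_of_dominated_loc_of_deriv_le (μ := torusMeasure) (x₀ := (0 : ℝ))
    (F := fun (t : ℝ) x => mFourier (-k) x * (f (x + Pi.single i (t : UnitAddCircle)) : ℂ))
    (F' := fun (t : ℝ) x => mFourier (-k) x *
      (TorusVortex.partialDeriv i f (x + Pi.single i (t : UnitAddCircle)) : ℂ))
    (bound := fun _ => C) (s := Set.univ) univ_mem ?_ ?_ ?_ ?_ ?_ ?_
  · have h4 := h3.2
    simp only [h1] at h4
    have h5 := h4.unique h2
    simpa [coeff] using h5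
  · refine Eventually.of_forall fun t => Continuous.aestronglyMeasurable ?_
    have := hf.continuous
    fun_prop
  · apply Continuous.integrable_of_hasCompactSupport _ (HasCompactSupport.of_compactSpace _)
    have := hf.continuous
    fun_prop
  · refine Continuous.aestronglyMeasurable ?_
    fun_prop
  · refine ae_of_all _ fun x t _ => ?_
    rw [norm_mul, norm_mFourier_apply, one_mul, Complex.norm_real]
    exact hC _ ⟨_, rfl⟩
  · exact integrable_const _
  · refine ae_of_all _ fun x t _ => ?_
    exact ((hf.hasDerivAt i x t).ofReal_comp).const_mul _

/-! ### Fourier coefficients of the Green function and its gradient. -/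

lemma normSq_nonneg (k : Fin 2 → ℤ) : 0 ≤ normSq k := by unfold normSq; positivity

lemma one_le_normSq {k : Fin 2 → ℤ} (hk : k ≠ 0) : 1 ≤ normSq k := by
  have h : 0 < k 0 ^ 2 + k 1 ^ 2 := by
    by_contra! h
    have h0 : k 0 = 0 := by nlinarith [sq_nonneg (k 0), sq_nonneg (k 1)]
    have h1 : k 1 = 0 := by nlinarith [sq_nonneg (k 0), sq_nonneg (k 1)]
    exact hk (funext fun i => by fin_cases i <;> simp [h0, h1])
  have h' : 1 ≤ k 0 ^ 2 + k 1 ^ 2 := h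
  unfold normSq
  exact_mod_cast h'

lemma normSq_pos {k : Fin 2 → ℤ} (hk : k ≠ 0) : 0 < normSq k := one_pos.trans_le (one_le_normSq hk)

@[simp] lemma normSq_zero : normSq 0 = 0 := by simp [normSq]

@[simp] lemma normSq_neg (k : Fin 2 → ℤ) : normSq (-k) = normSq k := by simp [normSq]

/-- Comparison with the Eisenstein sum of `‖k‖⁻⁴` in the sup norm, which is at most the Euclidean
norm. -/
lemma summable_inv_normSq_sq : Summable fun k : Fin 2 → ℤ => ((normSq k) ^ 2)⁻¹ := by
  have h := EisensteinSeries.summable_one_div_norm_rpow (k := 4) (by norm_num)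
  refine h.of_nonneg_of_le (fun k => by positivity) fun k => ?_
  rcases eq_or_ne k 0 with rfl | hk
  · simp
  · have hpos : 0 < ‖k‖ := norm_pos_iff.2 hk
    rw [Real.rpow_neg hpos.le]
    gcongr
    have h4 : ‖k‖ ^ (4 : ℝ) = (‖k‖ ^ 2) ^ 2 := by
      rw [← pow_mul]; exact_mod_cast Real.rpow_natCast ‖k‖ 4
    rw [h4]
    gcongr
    have hle : ‖k‖ ≤ √(normSq k) := by
      refine (pi_norm_le_iff_of_nonneg (Real.sqrt_nonneg _)).2 fun i => ?_
      rw [Int.norm_eq_abs]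
      refine Real.abs_le_sqrt ?_
      unfold normSq
      fin_cases i <;> simp <;> positivity
    exact (Real.le_sqrt (norm_nonneg _) (normSq_nonneg k)).1 hle

lemma integral_mFourier {k : Fin 2 → ℤ} (hk : k ≠ 0) : ∫ x, mFourier k x ∂torusMeasure = 0 := by
  have h := (orthonormal_iff_ite.1 (orthonormal_mFourier (d := Fin 2))) 0 k
  rw [if_neg hk.symm, ContinuousMap.inner_toLp] at h
  simpa [mFourier_zero] using! h

lemma coeff_ofReal {g : T2 → ℝ} (hg : Integrable g torusMeasure) (k : Fin 2 → ℤ) :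
    coeff (fun x => (g x : ℂ)) k = (∫ x, g x * (mFourier k x).re ∂torusMeasure : ℝ) -
      Complex.I * (∫ x, g x * (mFourier k x).im ∂torusMeasure : ℝ) := by
  have hi := integrable_mFourier_mul hg.ofReal (-k)
  have h1 := integral_re hi
  have h2 := integral_im hi
  apply Complex.ext
  · rw [coeff]
    refine h1.symm.trans ?_
    simp [mFourier_neg, mul_comm]
  · rw [coeff]
    refine h2.symm.trans ?_
    simp [mFourier_neg, mul_comm, integral_neg]

/-- The Fourier coefficients of `∂ᵢ G`. -/
def gradCoeff (i : Fin 2) (k : Fin 2 → ℤ) : ℂ := Complex.I * k i / (2 * Real.pi * normSq k)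

lemma IsGreenFunction.integral_mul_re {G : T2 → ℝ} (hG : IsGreenFunction G) {k : Fin 2 → ℤ}
    (hk : k ≠ 0) :
    ∫ x, G x * (mFourier k x).re ∂torusMeasure = (4 * Real.pi ^ 2 * normSq k)⁻¹ := by
  have h := hG.neg_laplacian _ (isSmooth_mFourier_re k)
  have h0 : ∫ x, (mFourier k x).re ∂torusMeasure = 0 := by
    have := integral_re (μ := torusMeasure) (f := fun x => mFourier k x)
      ((mFourier k).continuous.integrable_of_hasCompactSupport (HasCompactSupport.of_compactSpace _))
    simpa [integral_mFourier hk] using this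
  have h1 : (mFourier k 0).re = 1 := by simp [mFourier]
  simp only [laplacian_mFourier_re, neg_mul, neg_neg, mul_left_comm (G _), h0, h1,
    integral_const_mul] at h
  exact eq_inv_of_mul_eq_one_right (h.trans (sub_zero 1))

lemma IsGreenFunction.integral_mul_im {G : T2 → ℝ} (hG : IsGreenFunction G) {k : Fin 2 → ℤ}
    (hk : k ≠ 0) : ∫ x, G x * (mFourier k x).im ∂torusMeasure = 0 := by
  have h := hG.neg_laplacian _ (isSmooth_mFourier_im k)
  have h0 : ∫ x, (mFourier k x).im ∂torusMeasure = 0 := by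
    have := integral_im (μ := torusMeasure) (f := fun x => mFourier k x)
      ((mFourier k).continuous.integrable_of_hasCompactSupport (HasCompactSupport.of_compactSpace _))
    simpa [integral_mFourier hk] using this
  have h1 : (mFourier k 0).im = 0 := by simp [mFourier]
  simp only [laplacian_mFourier_im, neg_mul, neg_neg, mul_left_comm (G _), h0, h1,
    integral_const_mul, sub_zero] at h
  have := normSq_pos hk
  exact (mul_eq_zero.1 h).resolve_left (by positivity)

/-- The test functions are the real and imaginary parts of characters. At `k = 0` the constant test
function forces mean zero, in agreement with the value `0 / 0 = 0` of `gradCoeff`. -/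
lemma IsWeakPartialDeriv.coeff_eq {G H : T2 → ℝ} {i : Fin 2} (hH : IsWeakPartialDeriv i G H)
    (hG : IsGreenFunction G) (k : Fin 2 → ℤ) :
    coeff (fun x => (H x : ℂ)) k = gradCoeff i k := by
  have h1 := hH.integral_eq _ (isSmooth_mFourier_re k)
  have h2 := hH.integral_eq _ (isSmooth_mFourier_im k)
  simp only [partialDeriv_mFourier_re, partialDeriv_mFourier_im, mul_left_comm (G _),
    integral_const_mul] at h1 h2
  rw [coeff_ofReal hH.integrable, gradCoeff]
  rcases eq_or_ne k 0 with rfl | hk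
  · simp only [Pi.zero_apply, Int.cast_zero, mul_zero, neg_zero, zero_mul, zero_eq_neg] at h1 h2
    simp [h1, h2]
  · rw [hG.integral_mul_im hk, mul_zero, zero_eq_neg] at h1
    rw [hG.integral_mul_re hk, eq_comm, neg_eq_iff_eq_neg] at h2
    rw [h1, h2]
    have := (normSq_pos hk).ne'
    have hpi := Real.pi_ne_zero
    push_cast
    have a1 : (normSq k : ℂ) ≠ 0 := by exact_mod_cast this
    have a2 : (Real.pi : ℂ) ≠ 0 := by exact_mod_cast hpi
    field_simp
    ring

lemma IsSmooth.coeff_laplacian {f : T2 → ℝ} (hf : IsSmooth f) (k : Fin 2 → ℤ) :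
    coeff (fun x => (TorusVortex.laplacian f x : ℂ)) k =
      -(4 * Real.pi ^ 2 * normSq k) * coeff (fun x => (f x : ℂ)) k := by
  have hi (i : Fin 2) : Integrable (fun x => mFourier (-k) x *
      (TorusVortex.partialDeriv i (TorusVortex.partialDeriv i f) x : ℂ)) torusMeasure := by
    have := ((hf.partialDeriv i).partialDeriv i).continuous
    exact Continuous.integrable_of_hasCompactSupport (by fun_prop)
      (HasCompactSupport.of_compactSpace _)
  have h1 : coeff (fun x => (TorusVortex.laplacian f x : ℂ)) k =
      ∑ i, coeff (fun x => (TorusVortex.partialDeriv i (TorusVortex.partialDeriv i f) x : ℂ)) k := by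
    simp only [coeff, TorusVortex.laplacian, Complex.ofReal_sum, Finset.mul_sum]
    exact integral_finsetSum _ fun i _ => hi i
  rw [h1, Fin.sum_univ_two]
  simp only [(hf.partialDeriv _).coeff_partialDeriv, hf.coeff_partialDeriv, normSq]
  push_cast
  linear_combination (4 * Real.pi ^ 2 * ((k 0 : ℂ) ^ 2 + (k 1 : ℂ) ^ 2) *
    coeff (fun x => (f x : ℂ)) k) * Complex.I_sq

/-- Two Laplacians give decay `|k|⁻⁴`; one would give only `|k|⁻²`, which is not summable over `ℤ²`.
-/
lemma IsSmooth.summable_coeff {f : T2 → ℝ} (hf : IsSmooth f) :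
    Summable (coeff fun x => (f x : ℂ)) := by
  set C := ∫ x, ‖(TorusVortex.laplacian (TorusVortex.laplacian f) x : ℂ)‖ ∂torusMeasure
  have hb (k : Fin 2 → ℤ) : (normSq k) ^ 2 * ‖coeff (fun x => (f x : ℂ)) k‖ ≤ C := by
    refine le_trans ?_ (norm_coeff_le _ k)
    rw [hf.laplacian.coeff_laplacian, hf.coeff_laplacian, ← mul_assoc, norm_mul]
    gcongr
    have hpi := Real.pi_gt_three
    have : ‖-(4 * (Real.pi : ℂ) ^ 2 * normSq k) * -(4 * (Real.pi : ℂ) ^ 2 * normSq k)‖ =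
        (4 * Real.pi ^ 2) ^ 2 * (normSq k) ^ 2 := by
      simp [abs_of_nonneg (normSq_nonneg k)]
      ring
    rw [this]
    refine le_mul_of_one_le_left (by positivity) (one_le_pow₀ ?_)
    nlinarith
  have hC : 0 ≤ C := integral_nonneg fun x => norm_nonneg _
  refine Summable.of_norm_bounded_eventually (summable_inv_normSq_sq.mul_left C) ?_
  filter_upwards [(Set.finite_singleton (0 : Fin 2 → ℤ)).compl_mem_cofinite] with k hk
  have h := normSq_pos (show k ≠ 0 from hk)
  rw [← div_eq_mul_inv, le_div_iff₀ (by positivity), mul_comm]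
  exact hb k

lemma gradCoeff_neg (i : Fin 2) (k : Fin 2 → ℤ) : gradCoeff i (-k) = -gradCoeff i k := by
  simp [gradCoeff]; ring

lemma IsSmooth.continuous_ofReal {f : T2 → ℝ} (hf : IsSmooth f) :
    Continuous fun x => (f x : ℂ) := by
  have := hf.continuous
  fun_prop

lemma integral_re_mul_ofReal {g : T2 → ℂ} (hg : Integrable g torusMeasure) {f : T2 → ℝ}
    (hf : Continuous f) :
    ∫ x, (g x).re * f x ∂torusMeasure = (∫ x, g x * (f x : ℂ) ∂torusMeasure).re := by
  obtain ⟨C, hC⟩ := (isCompact_range hf).isBounded.exists_norm_le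
  have hi : Integrable (fun x => g x * (f x : ℂ)) torusMeasure :=
    hg.mul_bdd (c := C) (by fun_prop)
      (ae_of_all _ fun x => by rw [Complex.norm_real]; exact hC _ ⟨x, rfl⟩)
  have := integral_re hi
  simpa using this

/-- The Green function and its gradient exist as soon as integrable functions with the Fourier
coefficients of the gradient do. -/
lemma exists_greenFunction (hD : ∀ i, ∃ H : T2 → ℂ, Integrable H torusMeasure ∧
    ∀ k, coeff H k = gradCoeff i k) :
    ∃ (G : T2 → ℝ) (DG : Fin 2 → T2 → ℝ),
      IsGreenFunction G ∧ ∀ i, IsWeakPartialDeriv i G (DG i) := by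
  choose H hHi hH using hD
  -- At `k = 0` the inverse of zero is zero, which is the mean zero condition.
  obtain ⟨G, hG2, hG⟩ := exists_memLp_coeff_eq
    (a := fun k => ((4 * Real.pi ^ 2 * normSq k)⁻¹ : ℂ)) (by
      refine (summable_inv_normSq_sq.mul_left ((4 * Real.pi ^ 2)⁻¹ ^ 2)).congr fun k => ?_
      simp [abs_of_nonneg (normSq_nonneg k)]
      ring)
  have hGi : Integrable G torusMeasure := hG2.integrable (by norm_num)
  have hcG0 : ∫ x, G x ∂torusMeasure = 0 := by
    have := hG 0
    simpa [coeff, mFourier_zero] using this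
  -- Test functions are real, so passing to real parts preserves every required identity.
  refine ⟨fun x => (G x).re, fun i x => (H i x).re, ⟨hGi.re, ?_, fun f hf => ?_⟩,
    fun i => ⟨(hHi i).re, fun f hf => ?_⟩⟩
  · have := integral_re hGi
    simpa [hcG0] using this
  · rw [integral_re_mul_ofReal hGi hf.laplacian.neg.continuous]
    have h1 := hasSum_coeff_mul_coeff_neg hf.laplacian.neg.continuous_ofReal
      hf.laplacian.neg.summable_coeff hGi
    have h2 := hasSum_coeff_mul_mFourier hf.continuous_ofReal hf.summable_coeff 0
    have h3 := h2.sub (hasSum_ite_eq (0 : Fin 2 → ℤ) (coeff (fun x => (f x : ℂ)) 0))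
    have h4 : (fun k => coeff (fun x => ((-TorusVortex.laplacian f x : ℝ) : ℂ)) k * coeff G (-k)) =
        -- The Laplacian cancels the coefficients of `G` except at `k = 0`, where it vanishes. What
        -- remains is the Fourier series of `f` at the origin without its constant term, that is `f
        -- 0 - ∫ f`.
        fun k => coeff (fun x => (f x : ℂ)) k * mFourier k 0 -
          if k = 0 then coeff (fun x => (f x : ℂ)) 0 else 0 := by
      funext k
      have e : coeff (fun x => ((-TorusVortex.laplacian f x : ℝ) : ℂ)) k =
          (4 * Real.pi ^ 2 * normSq k) * coeff (fun x => (f x : ℂ)) k := by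
        have := hf.coeff_laplacian k
        rw [neg_mul] at this
        rw [← neg_eq_iff_eq_neg.2 this]
        simp [coeff, integral_neg]
      have e0 : mFourier k (0 : T2) = 1 := by simp [mFourier]
      rw [e, hG, e0, normSq_neg]
      split_ifs with hk
      · simp [hk]
      · have a1 : (normSq k : ℂ) ≠ 0 := by exact_mod_cast (normSq_pos hk).ne'
        have a2 : (Real.pi : ℂ) ≠ 0 := by exact_mod_cast Real.pi_ne_zero
        field_simp
        ring
    rw [h4] at h1
    rw [h1.unique h3, Complex.sub_re, Complex.ofReal_re]
    congr 1
    have : coeff (fun x => (f x : ℂ)) 0 = ((∫ x, f x ∂torusMeasure : ℝ) : ℂ) := by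
      rw [← integral_complex_ofReal]
      simp [coeff, mFourier_zero]
    rw [this, Complex.ofReal_re]
  · rw [integral_re_mul_ofReal hGi (hf.partialDeriv i).continuous,
      integral_re_mul_ofReal (hHi i) hf.continuous, ← Complex.neg_re]
    congr 1
    have h1 := hasSum_coeff_mul_coeff_neg (hf.partialDeriv i).continuous_ofReal
      (hf.partialDeriv i).summable_coeff hGi
    have h2 := (hasSum_coeff_mul_coeff_neg hf.continuous_ofReal hf.summable_coeff (hHi i)).neg
    refine h1.unique (h2.congr_fun fun k => ?_)
    rw [hf.coeff_partialDeriv, hG, hH, gradCoeff_neg, gradCoeff, normSq_neg]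
    rcases eq_or_ne k 0 with rfl | hk
    · simp
    · have a1 : (normSq k : ℂ) ≠ 0 := by exact_mod_cast (normSq_pos hk).ne'
      have a2 : (Real.pi : ℂ) ≠ 0 := by exact_mod_cast Real.pi_ne_zero
      field_simp
      ring

/-! ### Lattice sums of `|k|⁻²`. -/

lemma arctan_le_self {x : ℝ} (hx : 0 ≤ x) : Real.arctan x ≤ x := by
  have h := Real.le_tan (Real.arctan_nonneg.2 hx) (Real.arctan_lt_pi_div_two x)
  rwa [Real.tan_arctan] at h

lemma antitoneOn_inv_sq_add_sq (c a b : ℝ) (hc : 0 < c) (ha : 0 ≤ a) :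
    AntitoneOn (fun x : ℝ => (c ^ 2 + x ^ 2)⁻¹) (Set.Icc a b) := by
  intro x hx y hy hxy
  have h0 : 0 ≤ x := ha.trans hx.1
  simp only
  gcongr

lemma sum_inv_sq_add_sq_le (c : ℝ) (hc : 0 < c) (N : ℕ) :
    ∑ i ∈ Finset.range N, (c ^ 2 + ((i + 1 : ℕ) : ℝ) ^ 2)⁻¹ ≤ Real.pi / (2 * c) := by
  have h := (antitoneOn_inv_sq_add_sq c 0 (0 + N) hc le_rfl).sum_le_integral
  simp only [zero_add, integral_inv_sq_add_sq hc.ne', zero_div, Real.arctan_zero, sub_zero] at h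
  refine h.trans ?_
  rw [inv_mul_eq_div, div_le_div_iff₀ hc (by positivity)]
  nlinarith [Real.arctan_lt_pi_div_two (N / c)]

/-- Comparison with the integral over `[1, N + 1]`, an arctangent difference; the two error terms
are `arctan (c / N)` and `arctan (1 / c)`, each divided by `c`. -/
lemma le_sum_inv_sq_add_sq (c : ℝ) (hc : 0 < c) (N : ℕ) (hN : 0 < N) :
    Real.pi / (2 * c) - 1 / N - 1 / c ^ 2 ≤
      ∑ i ∈ Finset.range N, (c ^ 2 + ((i + 1 : ℕ) : ℝ) ^ 2)⁻¹ := by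
  have h := (antitoneOn_inv_sq_add_sq c 1 (1 + N) hc zero_le_one).integral_le_sum
  simp only [integral_inv_sq_add_sq hc.ne'] at h
  have e : ∀ i : ℕ, (1 + (i : ℝ)) = ((i + 1 : ℕ) : ℝ) := fun i => by push_cast; ring
  simp only [e] at h
  refine le_trans ?_ h
  have hN' : (0 : ℝ) < N := by exact_mod_cast hN
  have h1 : Real.arctan (1 / c) ≤ 1 / c := arctan_le_self (by positivity)
  have h2 : Real.arctan (N / c) ≤ Real.arctan ((N + 1 : ℕ) / c) :=
    Real.arctan_strictMono.monotone (by gcongr; simp)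
  have h3 : Real.arctan (N / c) = Real.pi / 2 - Real.arctan (c / N) := by
    rw [← Real.arctan_inv_of_pos (by positivity), inv_div]
  have h4 : Real.arctan (c / N) ≤ c / N := arctan_le_self (by positivity)
  have h5 : Real.pi / (2 * c) - 1 / N - 1 / c ^ 2 = c⁻¹ * (Real.pi / 2 - c / N - 1 / c) := by
    field_simp
  rw [h5]
  gcongr
  linarith

/-- A sum over the lattice lines `k₁ = n`. -/
lemma summable_and_tsum_int_inv_sq_add_sq_le (n : ℤ) (hn : n ≠ 0) :
    Summable (fun m : ℤ => ((m : ℝ) ^ 2 + (n : ℝ) ^ 2)⁻¹) ∧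
      ∑' m : ℤ, ((m : ℝ) ^ 2 + (n : ℝ) ^ 2)⁻¹ ≤ 5 / |(n : ℝ)| := by
  have hc : 0 < |(n : ℝ)| := abs_pos.2 (by exact_mod_cast hn)
  have hc1 : 1 ≤ |(n : ℝ)| := by exact_mod_cast Int.one_le_abs hn
  have hb := sum_inv_sq_add_sq_le _ hc
  simp only [sq_abs] at hb
  have hs : Summable fun i : ℕ => ((n : ℝ) ^ 2 + ((i + 1 : ℕ) : ℝ) ^ 2)⁻¹ :=
    summable_of_sum_range_le (fun i => by positivity) hb
  have ht := Real.tsum_le_of_sum_range_le (fun i => by positivity) hb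
  have hs0 : Summable fun i : ℕ => ((n : ℝ) ^ 2 + (i : ℝ) ^ 2)⁻¹ :=
    (summable_nat_add_iff (f := fun i : ℕ => ((n : ℝ) ^ 2 + (i : ℝ) ^ 2)⁻¹) 1).1 hs
  have e1 : (fun i : ℕ => ((((i : ℕ) : ℤ) : ℝ) ^ 2 + (n : ℝ) ^ 2)⁻¹) =
      fun i : ℕ => ((n : ℝ) ^ 2 + (i : ℝ) ^ 2)⁻¹ := by funext i; rw [add_comm]; simp
  have e2 : (fun i : ℕ => (((-((i : ℤ) + 1) : ℤ) : ℝ) ^ 2 + (n : ℝ) ^ 2)⁻¹) =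
      fun i : ℕ => ((n : ℝ) ^ 2 + ((i + 1 : ℕ) : ℝ) ^ 2)⁻¹ := by
    funext i; rw [add_comm]; push_cast; congr 2; ring
  have hS := HasSum.of_nat_of_neg_add_one (f := fun m : ℤ => ((m : ℝ) ^ 2 + (n : ℝ) ^ 2)⁻¹)
    (by rw [e1]; exact hs0.hasSum) (by rw [e2]; exact hs.hasSum)
  refine ⟨hS.summable, ?_⟩
  rw [hS.tsum_eq, hs0.tsum_eq_zero_add]
  have h2 : ((n : ℝ) ^ 2 + ((0 : ℕ) : ℝ) ^ 2)⁻¹ ≤ 1 / |(n : ℝ)| := by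
    rw [← sq_abs, one_div]
    gcongr
    simp only [CharP.cast_eq_zero]
    nlinarith
  -- The constant is `5 = 1 + 2 + 2`: the term `m = 0` and the two half-lines.
  have h3 : Real.pi / (2 * |(n : ℝ)|) ≤ 2 / |(n : ℝ)| := by
    rw [div_le_div_iff₀ (by positivity) hc]
    nlinarith [Real.pi_lt_four]
  have h4 : 5 / |(n : ℝ)| = 1 / |(n : ℝ)| + 2 / |(n : ℝ)| + 2 / |(n : ℝ)| := by ring
  rw [h4]
  gcongr
  · exact ht.trans h3
  · exact ht.trans h3

lemma summable_int_inv_sq_add_sq (n : ℤ) :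
    Summable (fun m : ℤ => ((m : ℝ) ^ 2 + (n : ℝ) ^ 2)⁻¹) := by
  rcases eq_or_ne n 0 with rfl | hn
  · simpa using Real.summable_one_div_int_pow.2 one_lt_two
  · exact (summable_and_tsum_int_inv_sq_add_sq_le n hn).1

/-- Summation of a nonnegative family on `ℤ²` supported on finitely many lines. -/
lemma summable_of_lines {w : (Fin 2 → ℤ) → ℝ} (hw : ∀ k, 0 ≤ w k) (T : Finset ℤ)
    (hT : ∀ k, k 1 ∉ T → w k = 0) (hs : ∀ n ∈ T, Summable fun m => w ![m, n]) :
    Summable w ∧ ∑' k, w k = ∑ n ∈ T, ∑' m, w ![m, n] := by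
  let e : ℤ × ℤ ≃ (Fin 2 → ℤ) := (Equiv.prodComm ℤ ℤ).trans (finTwoArrowEquiv ℤ).symm
  have he : ∀ p : ℤ × ℤ, e p = ![p.2, p.1] := fun p => rfl
  have h0 : ∀ n ∉ T, (fun m : ℤ => w ![m, n]) = 0 := fun n hn => funext fun m => hT _ hn
  have h0' : ∀ n ∉ T, ∑' m : ℤ, w ![m, n] = 0 := fun n hn => by
    rw [show (fun m : ℤ => w ![m, n]) = fun _ => 0 from h0 n hn, tsum_zero]
  have hsum : Summable (w ∘ e) := by
    refine (summable_prod_of_nonneg fun p => hw _).2 ⟨fun n => ?_, ?_⟩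
    · simp only [he]
      by_cases hn : n ∈ T
      · exact hs n hn
      · rw [h0 n hn]; exact summable_zero
    · refine summable_of_ne_finset_zero (s := T) fun n hn => ?_
      simp only [he, h0' n hn]
  refine ⟨e.summable_iff.1 hsum, ?_⟩
  rw [← e.tsum_eq, (show Summable fun p => w (e p) from hsum).tsum_prod]
  simp only [he]
  refine tsum_eq_sum fun n hn => ?_
  exact h0' n hn

/-- The box sum of `|k|⁻²`. -/
def boxSum (N : ℕ) : ℝ :=
  ∑ m ∈ Finset.Icc (-(N : ℤ)) N, ∑ n ∈ Finset.Icc (-(N : ℤ)) N, ((m : ℝ) ^ 2 + (n : ℝ) ^ 2)⁻¹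

lemma sum_Icc_neg_of_even (f : ℤ → ℝ) (hf : ∀ m, f (-m) = f m) (N : ℕ) :
    ∑ m ∈ Finset.Icc (-(N : ℤ)) N, f m =
      f 0 + 2 * ∑ i ∈ Finset.range N, f ((i + 1 : ℕ) : ℤ) := by
  induction N with
  | zero => simp
  | succ N ih =>
    have : Finset.Icc (-((N + 1 : ℕ) : ℤ)) ((N + 1 : ℕ) : ℤ) =
        insert (((N + 1 : ℕ) : ℤ)) (insert (-((N + 1 : ℕ) : ℤ)) (Finset.Icc (-(N : ℤ)) N)) := by
      ext m; simp only [Finset.mem_insert, Finset.mem_Icc]; omega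
    rw [this, Finset.sum_insert, Finset.sum_insert, ih, Finset.sum_range_succ, hf]
    · ring
    · simp only [Finset.mem_Icc]; omega
    · simp only [Finset.mem_insert, Finset.mem_Icc]; omega

lemma sum_inv_sq_le_two (N : ℕ) : ∑ i ∈ Finset.range N, (((i + 1 : ℕ) : ℝ) ^ 2)⁻¹ ≤ 2 := by
  have h : ∀ N : ℕ, ∑ i ∈ Finset.range (N + 1), (((i + 1 : ℕ) : ℝ) ^ 2)⁻¹ ≤ 2 - 1 / (N + 1) := by
    intro N
    induction N with
    | zero => norm_num
    | succ N ih =>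
      rw [Finset.sum_range_succ]
      have : (((N + 1 + 1 : ℕ) : ℝ) ^ 2)⁻¹ ≤ 1 / (N + 1) - 1 / ((N + 1 : ℕ) + 1) := by
        push_cast
        rw [inv_eq_one_div, div_sub_div _ _ (by positivity) (by positivity),
          div_le_div_iff₀ (by positivity) (by positivity)]
        nlinarith [(Nat.cast_nonneg N : (0 : ℝ) ≤ N)]
      linarith
  have h1 := h N
  rw [Finset.sum_range_succ] at h1
  have h2 : (0 : ℝ) ≤ 1 / (N + 1) := by positivity
  have h3 : (0 : ℝ) ≤ (((N + 1 : ℕ) : ℝ) ^ 2)⁻¹ := by positivity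
  linarith

/-- The row at height `m ≠ 0` sums to about `π / |m|`, so the two halves of the box contribute `2π`
times a harmonic number. The row `m = 0` is bounded, its term at the origin being `0⁻¹ = 0`. -/
lemma abs_boxSum_sub_log_le {N : ℕ} (hN : 0 < N) :
    |boxSum N - 2 * Real.pi * Real.log N| ≤ 16 := by
  have hN' : (0 : ℝ) < N := by exact_mod_cast hN
  let R : ℤ → ℝ := fun m => ∑ n ∈ Finset.Icc (-(N : ℤ)) N, ((m : ℝ) ^ 2 + (n : ℝ) ^ 2)⁻¹
  have hR (m : ℤ) : R m = ((m : ℝ) ^ 2)⁻¹ +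
      2 * ∑ j ∈ Finset.range N, ((m : ℝ) ^ 2 + ((j + 1 : ℕ) : ℝ) ^ 2)⁻¹ := by
    have := sum_Icc_neg_of_even (fun n : ℤ => ((m : ℝ) ^ 2 + (n : ℝ) ^ 2)⁻¹) (by simp) N
    simpa using this
  have hB : boxSum N = R 0 + 2 * ∑ i ∈ Finset.range N, R ((i + 1 : ℕ) : ℤ) :=
    sum_Icc_neg_of_even R (fun m => by simp [R]) N
  have hR0 : R 0 = 2 * ∑ j ∈ Finset.range N, (((j + 1 : ℕ) : ℝ) ^ 2)⁻¹ := by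
    rw [hR]; simp
  have h2 := sum_inv_sq_le_two N
  have h2' : 0 ≤ ∑ j ∈ Finset.range N, (((j + 1 : ℕ) : ℝ) ^ 2)⁻¹ :=
    Finset.sum_nonneg fun j _ => by positivity
  have hH : ((harmonic N : ℚ) : ℝ) = ∑ j ∈ Finset.range N, (((j + 1 : ℕ) : ℝ))⁻¹ := by
    simp [harmonic]
  have hHl := log_add_one_le_harmonic N
  have hHu := harmonic_le_one_add_log N
  have hlog : Real.log N ≤ Real.log ((N + 1 : ℕ) : ℝ) := by gcongr; simp
  have hup : ∑ i ∈ Finset.range N, R ((i + 1 : ℕ) : ℤ) ≤ Real.pi * harmonic N + 2 := by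
    calc ∑ i ∈ Finset.range N, R ((i + 1 : ℕ) : ℤ)
        ≤ ∑ i ∈ Finset.range N, (Real.pi * (((i + 1 : ℕ) : ℝ))⁻¹ + (((i + 1 : ℕ) : ℝ) ^ 2)⁻¹) := by
          refine Finset.sum_le_sum fun i _ => ?_
          have hc : (0 : ℝ) < ((i + 1 : ℕ) : ℝ) := by positivity
          have h := sum_inv_sq_add_sq_le _ hc N
          have e : Real.pi / (2 * ((i + 1 : ℕ) : ℝ)) = Real.pi * ((i + 1 : ℕ) : ℝ)⁻¹ / 2 := by
            field_simp
          rw [hR, Int.cast_natCast]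
          linarith
      _ ≤ _ := by rw [Finset.sum_add_distrib, ← Finset.mul_sum, ← hH]; gcongr
  have hlo : Real.pi * harmonic N - 6 ≤ ∑ i ∈ Finset.range N, R ((i + 1 : ℕ) : ℤ) := by
    calc Real.pi * harmonic N - 6
        ≤ ∑ i ∈ Finset.range N, (Real.pi * (((i + 1 : ℕ) : ℝ))⁻¹ - 2 / N -
            2 * (((i + 1 : ℕ) : ℝ) ^ 2)⁻¹) := by
          rw [Finset.sum_sub_distrib, Finset.sum_sub_distrib, ← Finset.mul_sum, ← Finset.mul_sum,
            ← hH, Finset.sum_const, Finset.card_range, nsmul_eq_mul, mul_div_cancel₀ _ hN'.ne']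
          linarith
      _ ≤ _ := by
          refine Finset.sum_le_sum fun i _ => ?_
          have hc : (0 : ℝ) < ((i + 1 : ℕ) : ℝ) := by positivity
          have h := le_sum_inv_sq_add_sq _ hc N hN
          have h0 : (0 : ℝ) ≤ (((i + 1 : ℕ) : ℝ) ^ 2)⁻¹ := by positivity
          have e : Real.pi / (2 * ((i + 1 : ℕ) : ℝ)) = Real.pi * ((i + 1 : ℕ) : ℝ)⁻¹ / 2 := by
            field_simp
          have e2 : (2 : ℝ) / N = 2 * (1 / N) := by ring
          rw [one_div (((i + 1 : ℕ) : ℝ) ^ 2)] at h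
          rw [hR, Int.cast_natCast]
          linarith
  rw [hB, hR0]
  have hpi := Real.pi_pos
  have hpi4 := Real.pi_lt_four
  have hu2 : Real.pi * harmonic N ≤ Real.pi + Real.pi * Real.log N := by nlinarith
  have hl2 : Real.pi * Real.log N ≤ Real.pi * harmonic N := by gcongr; exact hlog.trans hHl
  rw [abs_le]
  constructor <;> nlinarith

/-! ### Integrability of the gradient of the Green function. -/

/-- Fourier coefficients of the limit of an absolutely convergent series in `L¹`. -/
lemma exists_integrable_hasSum_coeff {F : ℕ → T2 → ℂ} (hF : ∀ j, Integrable (F j) torusMeasure)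
    (hs : Summable fun j => ∫ x, ‖F j x‖ ∂torusMeasure) :
    ∃ H : T2 → ℂ, Integrable H torusMeasure ∧
      ∀ k, HasSum (fun j => coeff (F j) k) (coeff H k) := by
  let Φ : ℕ → Lp ℂ 1 torusMeasure := fun j => (hF j).toL1 (F j)
  have hΦ : Summable Φ := by
    refine Summable.of_norm (hs.congr fun j => ?_)
    rw [L1.norm_of_fun_eq_integral_norm]
  refine ⟨(∑' j, Φ j : Lp ℂ 1 torusMeasure), L1.integrable_coeFn _, fun k => ?_⟩
  let T : Lp ℂ 1 torusMeasure →ₗ[ℂ] ℂ :=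
    { toFun := fun g => coeff g k
      map_add' := fun g h => by
        rw [coeff_congr_ae (Lp.coeFn_add g h)]
        simp only [coeff, Pi.add_apply, mul_add]
        exact integral_add (integrable_mFourier_mul (L1.integrable_coeFn g) _)
          (integrable_mFourier_mul (L1.integrable_coeFn h) _)
      map_smul' := fun c g => by
        rw [coeff_congr_ae (Lp.coeFn_smul c g)]
        simp only [coeff, Pi.smul_apply, smul_eq_mul, mul_left_comm _ c, integral_const_mul,
          RingHom.id_apply] }
  -- A Fourier coefficient is a continuous functional on `L¹`, so it commutes with the
  -- norm-convergent sum.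
  let T' : Lp ℂ 1 torusMeasure →L[ℂ] ℂ := T.mkContinuous 1 fun g => by
    rw [one_mul, L1.norm_eq_integral_norm]
    exact norm_coeff_le g k
  have h := T'.hasSum hΦ.hasSum
  refine h.congr_fun fun j => ?_
  exact (coeff_congr_ae (hF j).coeFn_toL1 k).symm

/-- The first basis character. -/
abbrev char0 : T2 → ℂ := mFourier (Pi.single 0 1)

lemma norm_char0 (x : T2) : ‖char0 x‖ = 1 := norm_mFourier_apply _ x

lemma char0_pow (n : ℕ) (x : T2) : char0 x ^ n = mFourier (Pi.single 0 (n : ℤ)) x := by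
  induction n with
  | zero => simp [mFourier_zero]
  | succ n ih =>
    rw [pow_succ, ih, Nat.cast_succ, Pi.single_add, mFourier_add]

lemma one_sub_mul_char0_ne_zero {r : ℝ} (hr0 : 0 ≤ r) (hr : r < 1) (x : T2) :
    (1 : ℂ) - r * char0 x ≠ 0 := by
  intro h
  have h1 : ‖(r : ℂ) * char0 x‖ = 1 := by rw [← sub_eq_zero.1 h, norm_one]
  rw [norm_mul, norm_char0, mul_one, Complex.norm_real, Real.norm_of_nonneg hr0] at h1
  exact hr.ne h1

/-- Expand as a geometric series; only the constant character has nonzero mean. -/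
lemma integral_inv_one_sub_mul_char0 {r : ℝ} (hr0 : 0 ≤ r) (hr : r < 1) :
    ∫ x, (1 - r * char0 x)⁻¹ ∂torusMeasure = 1 := by
  have key := hasSum_integral_of_summable_integral_norm (μ := torusMeasure)
    (F := fun (n : ℕ) x => (r : ℂ) ^ n * char0 x ^ n)
    (fun n => Continuous.integrable_of_hasCompactSupport (by fun_prop)
      (HasCompactSupport.of_compactSpace _)) (by
      simp only [norm_mul, norm_pow, norm_char0, one_pow, mul_one, Complex.norm_real,
        Real.norm_of_nonneg hr0, integral_const]
      simpa using summable_geometric_of_lt_one hr0 hr)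
  have e1 : ∀ n : ℕ, ∫ x, (r : ℂ) ^ n * char0 x ^ n ∂torusMeasure = if n = 0 then 1 else 0 := by
    intro n
    rw [integral_const_mul]
    simp only [char0_pow]
    split_ifs with h
    · simp [h, mFourier_zero]
    · rw [integral_mFourier (by simpa using h), mul_zero]
  simp only [e1] at key
  have e2 : ∀ x, ∑' n : ℕ, (r : ℂ) ^ n * char0 x ^ n = (1 - r * char0 x)⁻¹ := fun x => by
    simp only [← mul_pow]
    refine tsum_geometric_of_norm_lt_one ?_
    rwa [norm_mul, norm_char0, mul_one, Complex.norm_real, Real.norm_of_nonneg hr0]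
  simp only [e2] at key
  exact key.unique (hasSum_ite_eq 0 1)

lemma continuous_inv_one_sub_mul_char0 {r : ℝ} (hr0 : 0 ≤ r) (hr : r < 1) :
    Continuous fun x => ((1 : ℂ) - r * char0 x)⁻¹ :=
  Continuous.inv₀ (by fun_prop) (one_sub_mul_char0_ne_zero hr0 hr)

lemma integral_norm_inv_one_sub_mul_char0_sq {r : ℝ} (hr0 : 0 ≤ r) (hr : r < 1) :
    ∫ x, ‖(1 - r * char0 x)⁻¹‖ ^ 2 ∂torusMeasure = (1 - r ^ 2)⁻¹ := by
  have hc := continuous_inv_one_sub_mul_char0 hr0 hr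
  have hi : Integrable (fun x => ((1 : ℂ) - r * char0 x)⁻¹) torusMeasure :=
    hc.integrable_of_hasCompactSupport (HasCompactSupport.of_compactSpace _)
  have hr2 : 0 < 1 - r ^ 2 := by nlinarith
  -- The Poisson kernel identity on the unit circle, which reduces the square norm to the mean of
  -- `(1 - r z)⁻¹`.
  have e (x : T2) : ‖(1 - r * char0 x)⁻¹‖ ^ 2 =
      (1 - r ^ 2)⁻¹ * (2 * ((1 - r * char0 x)⁻¹).re - 1) := by
    have h0 : Complex.normSq (1 - r * char0 x) ≠ 0 := by
      simpa using one_sub_mul_char0_ne_zero hr0 hr x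
    have h1 : Complex.normSq (char0 x) = 1 := by
      rw [Complex.normSq_eq_norm_sq, norm_char0, one_pow]
    have h2 : Complex.normSq (1 - r * char0 x) = 1 - 2 * r * (char0 x).re + r ^ 2 := by
      rw [Complex.normSq_apply] at h1
      rw [Complex.normSq_apply]
      simp
      linear_combination r ^ 2 * h1
    have h3 : ((1 : ℂ) - r * char0 x).re = 1 - r * (char0 x).re := by simp
    rw [norm_inv, inv_pow, ← Complex.normSq_eq_norm_sq, Complex.inv_re, h3]
    field_simp
    rw [h2]
    ring
  have h2 : ∫ x, ((1 - r * char0 x)⁻¹).re ∂torusMeasure = 1 := by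
    refine (integral_re hi).trans ?_
    rw [integral_inv_one_sub_mul_char0 hr0 hr]; simp
  have hi' : Integrable (fun x => ((1 - r * char0 x)⁻¹).re) torusMeasure := hi.re
  simp only [e]
  rw [integral_const_mul, integral_sub (hi'.const_mul 2) (integrable_const _), integral_const_mul,
    h2]
  simp
  norm_num

lemma coeff_one_sub_mul_char0_mul {f : T2 → ℂ} (hf : Integrable f torusMeasure) (r : ℝ)
    (k : Fin 2 → ℤ) :
    coeff (fun x => (1 - r * char0 x) * f x) k = coeff f k - r * coeff f (k - Pi.single 0 1) := by
  have e (x : T2) : mFourier (-k) x * ((1 - r * char0 x) * f x) =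
      mFourier (-k) x * f x - r * (mFourier (-(k - Pi.single 0 1)) x * f x) := by
    rw [show -(k - Pi.single 0 1) = -k + Pi.single 0 1 by abel, mFourier_add]
    ring
  simp only [coeff, e]
  rw [integral_sub (integrable_mFourier_mul hf _) ((integrable_mFourier_mul hf _).const_mul _),
    integral_const_mul]

/-- An `L¹` bound by the decay of the increments of the Fourier coefficients. -/
lemma integral_norm_le_of_coeff {f : T2 → ℂ} (hf : MemLp f 2 torusMeasure) {r s : ℝ} (hr0 : 0 ≤ r)
    (hr : r < 1) (hs : 0 < s) :
    ∫ x, ‖f x‖ ∂torusMeasure ≤ s / 2 * (1 - r ^ 2)⁻¹ +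
      1 / (2 * s) * ∑' k, ‖coeff f k - r * coeff f (k - Pi.single 0 1)‖ ^ 2 := by
  have hfi : Integrable f torusMeasure := hf.integrable (by norm_num)
  have hc := continuous_inv_one_sub_mul_char0 hr0 hr
  have hg : MemLp (fun x => (1 - r * char0 x) * f x) 2 torusMeasure := by
    refine MemLp.of_le_mul (c := 2) hf
      ((Continuous.aestronglyMeasurable (by fun_prop)).mul hf.1) (ae_of_all _ fun x => ?_)
    rw [norm_mul]
    gcongr
    refine (norm_sub_le _ _).trans ?_
    rw [norm_one, norm_mul, norm_char0, mul_one, Complex.norm_real, Real.norm_of_nonneg hr0]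
    linarith
  have hP := (hasSum_sq_norm_coeff hg).tsum_eq
  simp only [coeff_one_sub_mul_char0_mul hfi] at hP
  have hA : Integrable (fun x => s / 2 * ‖(1 - r * char0 x)⁻¹‖ ^ 2) torusMeasure :=
    ((hc.norm.pow 2).integrable_of_hasCompactSupport (HasCompactSupport.of_compactSpace _)).const_mul _
  have hB : Integrable (fun x => 1 / (2 * s) * ‖(1 - r * char0 x) * f x‖ ^ 2) torusMeasure :=
    (hg.integrable_norm_pow (by norm_num)).const_mul _
  rw [hP, ← integral_norm_inv_one_sub_mul_char0_sq hr0 hr, ← integral_const_mul,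
    ← integral_const_mul, ← integral_add]
  · refine integral_mono hfi.norm ?_ fun x => ?_
    · exact hA.add hB
    -- Split off the weight `1 - r z` and apply Young's inequality with parameter `s`. The weight
    -- turns coefficients into increments.
    · have e : ‖f x‖ = ‖(1 - r * char0 x)⁻¹‖ * ‖(1 - r * char0 x) * f x‖ := by
        rw [← norm_mul, inv_mul_cancel_left₀ (one_sub_mul_char0_ne_zero hr0 hr x)]
      simp only
      rw [e]
      set a := ‖(1 - r * char0 x)⁻¹‖
      set b := ‖(1 - r * char0 x) * f x‖
      have : s / 2 * a ^ 2 + 1 / (2 * s) * b ^ 2 - a * b = (s * a - b) ^ 2 / (2 * s) := by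
        field_simp; ring
      have h2 : 0 ≤ (s * a - b) ^ 2 / (2 * s) := by positivity
      linarith
  · exact hA
  · exact hB

lemma gradCoeff_eq (i : Fin 2) (k : Fin 2 → ℤ) :
    gradCoeff i k = Complex.I / (2 * Real.pi) * ((k i / normSq k : ℝ) : ℂ) := by
  simp only [gradCoeff]
  push_cast
  rw [div_mul_div_comm]

lemma norm_I_div_two_pi_sq_le : ‖Complex.I / (2 * Real.pi)‖ ^ 2 ≤ 1 := by
  rw [sq_le_one_iff₀ (norm_nonneg _)]
  simp only [norm_div, Complex.norm_I, norm_mul, Complex.norm_ofNat, Complex.norm_real,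
    Real.norm_of_nonneg Real.pi_nonneg]
  rw [div_le_one (by positivity)]
  linarith [Real.pi_gt_three]

lemma norm_gradCoeff_sq_le (i : Fin 2) (k : Fin 2 → ℤ) :
    ‖gradCoeff i k‖ ^ 2 ≤ (normSq k)⁻¹ := by
  rw [gradCoeff_eq, norm_mul, mul_pow, Complex.norm_real, Real.norm_eq_abs, sq_abs]
  refine (mul_le_of_le_one_left (by positivity) norm_I_div_two_pi_sq_le).trans ?_
  rcases eq_or_ne k 0 with rfl | hk
  · simp
  · have := normSq_pos hk
    rw [div_pow, div_le_iff₀ (by positivity), pow_two (normSq k), inv_mul_cancel_left₀ this.ne']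
    unfold normSq
    fin_cases i <;> simp <;> positivity

/-- Up to a constant factor, the vector of both components is the inversion `k / |k|²`, for which
`|k/|k|² - l/|l|²|² = |k - l|² / (|k|²|l|²)`. -/
lemma norm_gradCoeff_sub_sq_le (i : Fin 2) {k l : Fin 2 → ℤ} (hk : k ≠ 0) (hl : l ≠ 0)
    (hkl : normSq (k - l) = 1) :
    ‖gradCoeff i k - gradCoeff i l‖ ^ 2 ≤ (normSq k)⁻¹ * (normSq l)⁻¹ := by
  rw [gradCoeff_eq, gradCoeff_eq, ← mul_sub, ← Complex.ofReal_sub, norm_mul, mul_pow,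
    Complex.norm_real, Real.norm_eq_abs, sq_abs]
  refine (mul_le_of_le_one_left (by positivity) norm_I_div_two_pi_sq_le).trans ?_
  have h1 : (k i / normSq k - l i / normSq l) ^ 2 ≤
      (k 0 / normSq k - l 0 / normSq l) ^ 2 + (k 1 / normSq k - l 1 / normSq l) ^ 2 := by
    fin_cases i <;> simp <;> positivity
  refine h1.trans_eq ?_
  have hA := (normSq_pos hk).ne'
  have hB := (normSq_pos hl).ne'
  have h2 : ((k 0 : ℝ) - l 0) ^ 2 + ((k 1 : ℝ) - l 1) ^ 2 = 1 := by
    simpa [normSq] using hkl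
  have eA : (k 0 : ℝ) ^ 2 + (k 1 : ℝ) ^ 2 = normSq k := rfl
  have eB : (l 0 : ℝ) ^ 2 + (l 1 : ℝ) ^ 2 = normSq l := rfl
  field_simp
  linear_combination (normSq k * normSq l) * h2 + (normSq l ^ 2 - normSq k * normSq l) * eA +
    (normSq k ^ 2 - normSq k * normSq l) * eB

/-- The part of the Fourier coefficients of `∂ᵢ G` with `2 ^ (j - 1) ≤ |k₁| < 2 ^ j`. -/
def blockCoeff (i : Fin 2) (j : ℕ) (k : Fin 2 → ℤ) : ℂ :=
  if (k 1).natAbs.size = j then gradCoeff i k else 0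

lemma size_natAbs_ne {j : ℕ} {n : ℤ} (hn : n ∉ Finset.Icc (-(2 ^ j : ℤ)) (2 ^ j)) :
    n.natAbs.size ≠ j := by
  rintro rfl
  refine hn (Finset.mem_Icc.2 (abs_le.1 ?_))
  rw [Int.abs_eq_natAbs]
  exact_mod_cast (Nat.lt_size_self n.natAbs).le

lemma summable_norm_blockCoeff_sq (i : Fin 2) (j : ℕ) :
    Summable fun k => ‖blockCoeff i j k‖ ^ 2 := by
  refine (summable_of_lines (fun k => by positivity) (Finset.Icc (-(2 ^ j : ℤ)) (2 ^ j))
    (fun k hk => ?_) fun n _ => ?_).1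
  · simp [blockCoeff, size_natAbs_ne hk]
  · refine (summable_int_inv_sq_add_sq n).of_nonneg_of_le (fun m => by positivity) fun m => ?_
    have := norm_gradCoeff_sq_le i ![m, n]
    simp only [blockCoeff]
    split_ifs
    · simpa [normSq] using this
    · simp; positivity

lemma sub_single_zero (m n : ℤ) : (![m, n] : Fin 2 → ℤ) - Pi.single 0 1 = ![m - 1, n] := by
  ext i; fin_cases i <;> simp

lemma norm_gradCoeff_increment_sq_le (i : Fin 2) {m n : ℤ} (hn : n ≠ 0) {q : ℝ} (hq : 1 ≤ q)
    (hqn : q ≤ 2 * |(n : ℝ)|) :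
    ‖gradCoeff i ![m, n] - (1 - q⁻¹ : ℝ) * gradCoeff i ![m - 1, n]‖ ^ 2 ≤
      10 / q ^ 2 * (((m - 1 : ℤ) : ℝ) ^ 2 + (n : ℝ) ^ 2)⁻¹ := by
  have hk : (![m, n] : Fin 2 → ℤ) ≠ 0 := fun h => hn (congrFun h 1)
  have hl : (![m - 1, n] : Fin 2 → ℤ) ≠ 0 := fun h => hn (congrFun h 1)
  have h1 := norm_gradCoeff_sub_sq_le i hk hl (by simp [normSq])
  have h2 := norm_gradCoeff_sq_le i ![m - 1, n]
  set a := gradCoeff i ![m, n]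
  set b := gradCoeff i ![m - 1, n]
  have hB : normSq ![m - 1, n] = ((m - 1 : ℤ) : ℝ) ^ 2 + (n : ℝ) ^ 2 := rfl
  rw [← hB]
  have hBpos := normSq_pos hl
  have hA : (normSq ![m, n])⁻¹ ≤ 4 / q ^ 2 := by
    have e : normSq ![m, n] = (m : ℝ) ^ 2 + (n : ℝ) ^ 2 := rfl
    have : q ^ 2 / 4 ≤ normSq ![m, n] := by
      rw [e]
      nlinarith [sq_abs (n : ℝ), sq_nonneg (m : ℝ), abs_nonneg (n : ℝ)]
    rw [← inv_div]
    gcongr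
  -- The true increment gains `|k|⁻² ≤ 4/q²` and the correction gains `q⁻²`, whence `10 = 2 · (4 +
  -- 1)`.
  have e : a - (1 - q⁻¹ : ℝ) * b = (a - b) + (q⁻¹ : ℝ) * b := by push_cast; ring
  have h3 : ‖a - (1 - q⁻¹ : ℝ) * b‖ ≤ ‖a - b‖ + q⁻¹ * ‖b‖ := by
    rw [e]
    refine (norm_add_le _ _).trans_eq ?_
    rw [norm_mul, Complex.norm_real, Real.norm_of_nonneg (by positivity)]
  calc ‖a - (1 - q⁻¹ : ℝ) * b‖ ^ 2 ≤ (‖a - b‖ + q⁻¹ * ‖b‖) ^ 2 := by gcongr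
    _ ≤ 2 * ‖a - b‖ ^ 2 + 2 * (q⁻¹ ^ 2 * ‖b‖ ^ 2) := by
      nlinarith [sq_nonneg (‖a - b‖ - q⁻¹ * ‖b‖)]
    _ ≤ 2 * (4 / q ^ 2 * (normSq ![m - 1, n])⁻¹) + 2 * (q⁻¹ ^ 2 * (normSq ![m - 1, n])⁻¹) := by
      gcongr
      exact h1.trans (by gcongr)
    _ = _ := by field_simp; norm_num

lemma tsum_blockCoeff_increment_le (i : Fin 2) (j : ℕ) :
    ∑' k, ‖blockCoeff i (j + 1) k -
      (1 - (2 ^ (j + 1))⁻¹ : ℝ) * blockCoeff i (j + 1) (k - Pi.single 0 1)‖ ^ 2 ≤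
      300 / (2 ^ (j + 1)) ^ 2 := by
  set q : ℝ := 2 ^ (j + 1) with hq
  have hq1 : 1 ≤ q := one_le_pow₀ (by norm_num)
  set w : (Fin 2 → ℤ) → ℝ := fun k => ‖blockCoeff i (j + 1) k -
      (1 - q⁻¹ : ℝ) * blockCoeff i (j + 1) (k - Pi.single 0 1)‖ ^ 2 with hw
  -- At most `3q` lines meet the block, and each contributes at most `100 / q³`.
  set T := Finset.Icc (-(2 ^ (j + 1) : ℤ)) (2 ^ (j + 1))
  have hline (n : ℤ) : (Summable fun m => w ![m, n]) ∧ ∑' m, w ![m, n] ≤ 100 / q ^ 3 := by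
    by_cases hn : n.natAbs.size = j + 1
    · have hn0 : n ≠ 0 := by rintro rfl; simp at hn
      have hnq : q ≤ 2 * |(n : ℝ)| := by
        have : 2 ^ j ≤ n.natAbs := Nat.lt_size.1 (by omega)
        have h' : (2 : ℝ) ^ j ≤ |(n : ℝ)| := by
          rw [← Int.cast_abs, Int.abs_eq_natAbs]
          exact_mod_cast this
        rw [hq, pow_succ]
        linarith
      have hwle (m : ℤ) : w ![m, n] ≤ 10 / q ^ 2 * (((m - 1 : ℤ) : ℝ) ^ 2 + (n : ℝ) ^ 2)⁻¹ := by
        refine le_trans (le_of_eq ?_) (norm_gradCoeff_increment_sq_le i hn0 hq1 hnq)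
        simp only [hw, sub_single_zero]
        simp [blockCoeff, hn]
      obtain ⟨hs, ht⟩ := summable_and_tsum_int_inv_sq_add_sq_le n hn0
      have hs' := (Equiv.subRight (1 : ℤ)).summable_iff.2 hs
      have ht' := (Equiv.subRight (1 : ℤ)).tsum_eq fun m : ℤ => ((m : ℝ) ^ 2 + (n : ℝ) ^ 2)⁻¹
      have hs2 : Summable fun m : ℤ => 10 / q ^ 2 * (((m - 1 : ℤ) : ℝ) ^ 2 + (n : ℝ) ^ 2)⁻¹ :=
        hs'.mul_left _
      have hsw : Summable fun m => w ![m, n] := hs2.of_nonneg_of_le (fun m => by positivity) hwle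
      refine ⟨hsw, (hsw.tsum_le_tsum hwle hs2).trans ?_⟩
      rw [tsum_mul_left]
      have e : ∑' m : ℤ, (((m - 1 : ℤ) : ℝ) ^ 2 + (n : ℝ) ^ 2)⁻¹ ≤ 10 / q := by
        refine (ht'.trans_le ht).trans ?_
        have hnpos : 0 < |(n : ℝ)| := by linarith
        rw [div_le_div_iff₀ hnpos (by positivity)]
        linarith
      calc 10 / q ^ 2 * _ ≤ 10 / q ^ 2 * (10 / q) := by gcongr
        _ = _ := by field_simp; norm_num
    · have : (fun m => w ![m, n]) = fun _ => 0 := by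
        funext m
        simp [hw, blockCoeff, hn]
      rw [this, tsum_zero]
      exact ⟨summable_zero, by positivity⟩
  have h := (summable_of_lines (w := w) (fun k => by positivity) T (fun k hk => by
    have h1 := size_natAbs_ne hk
    simp [hw, blockCoeff, h1]) fun n _ => (hline n).1).2
  rw [h]
  refine (Finset.sum_le_card_nsmul T _ _ fun n _ => (hline n).2).trans ?_
  have hT : (T.card : ℝ) ≤ 3 * q := by
    have : (T.card : ℤ) = 2 * 2 ^ (j + 1) + 1 := by
      simp only [T, Int.card_Icc]
      have hp : (0 : ℤ) < 2 ^ (j + 1) := by positivity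
      rw [Int.toNat_of_nonneg (by linarith)]
      ring
    have h2 : (T.card : ℝ) = 2 * q + 1 := by rw [hq]; exact_mod_cast this
    linarith
  rw [nsmul_eq_mul]
  calc (T.card : ℝ) * (100 / q ^ 3) ≤ 3 * q * (100 / q ^ 3) := by gcongr
    _ = _ := by field_simp; norm_num

/-- The distributional derivatives of the Green function are integrable. -/
lemma exists_integrable_coeff_eq_gradCoeff (i : Fin 2) :
    ∃ H : T2 → ℂ, Integrable H torusMeasure ∧ ∀ k, coeff H k = gradCoeff i k := by
  choose F hF2 hF using fun j => exists_memLp_coeff_eq (summable_norm_blockCoeff_sq i j)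
  have hFi (j : ℕ) : Integrable (F j) torusMeasure := (hF2 j).integrable (by norm_num)
  have hb (j : ℕ) : ∫ x, ‖F (j + 1) x‖ ∂torusMeasure ≤
      1 / 2 * (2 / 3) ^ (j + 1) + 150 * (3 / 4) ^ (j + 1) := by
    set q : ℝ := 2 ^ (j + 1) with hq
    have hq1 : 1 ≤ q := one_le_pow₀ (by norm_num)
    have hqi : 0 < q⁻¹ := by positivity
    have hqi1 : q⁻¹ ≤ 1 := inv_le_one_of_one_le₀ hq1
    -- With `r = 1 - 1/q` and `s = 1/t` the bound is `q/(2t) + 150 t/q²`. Both terms decay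
    -- geometrically because `2 < 3 < 4`.
    set t : ℝ := 3 ^ (j + 1) with ht
    have htpos : 0 < t := by positivity
    have h1 := integral_norm_le_of_coeff (hF2 (j + 1)) (r := 1 - q⁻¹) (s := t⁻¹) (by linarith)
      (by linarith) (by positivity)
    simp only [hF] at h1
    have h2 := tsum_blockCoeff_increment_le i j
    rw [← hq] at h2
    have h3 : (1 - (1 - q⁻¹) ^ 2)⁻¹ ≤ q := by
      rw [inv_le_comm₀ (by nlinarith) (by positivity)]
      nlinarith
    have e1 : ((2 : ℝ) / 3) ^ (j + 1) = t⁻¹ * q := by rw [div_pow, mul_comm]; rfl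
    have e2 : ((3 : ℝ) / 4) ^ (j + 1) = t / q ^ 2 := by
      rw [div_pow, hq, ← pow_mul, mul_comm (j + 1), pow_mul]; norm_num [ht]
    rw [e1, e2]
    calc _ ≤ _ := h1
      _ ≤ t⁻¹ / 2 * q + 1 / (2 * t⁻¹) * (300 / q ^ 2) := by gcongr
      _ = _ := by field_simp; ring
  have hs : Summable fun j => ∫ x, ‖F j x‖ ∂torusMeasure := by
    -- Block `0` is the line `k₁ = 0`; only its integrability is needed.
    rw [← summable_nat_add_iff 1]
    refine Summable.of_nonneg_of_le (fun j => integral_nonneg fun x => norm_nonneg _) hb ?_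
    refine Summable.add ?_ ?_
    · exact ((summable_nat_add_iff 1).2
        (summable_geometric_of_lt_one (by norm_num) (by norm_num))).mul_left _
    · exact ((summable_nat_add_iff 1).2
        (summable_geometric_of_lt_one (by norm_num) (by norm_num))).mul_left _
  obtain ⟨H, hHi, hH⟩ := exists_integrable_hasSum_coeff hFi hs
  refine ⟨H, hHi, fun k => (hH k).unique ?_⟩
  simp only [hF, blockCoeff]
  simp only [eq_comm (a := (k 1).natAbs.size)]
  exact hasSum_ite_eq _ _

lemma exists_greenFunction_gradient :
    ∃ (G : T2 → ℝ) (DG : Fin 2 → T2 → ℝ),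
      IsGreenFunction G ∧ ∀ i, IsWeakPartialDeriv i G (DG i) :=
  exists_greenFunction exists_integrable_coeff_eq_gradCoeff

/-! ### Fourier transforms of rescaled radial densities. -/

lemma measurable_rep : Measurable rep :=
  (PiLp.volume_preserving_toLp (Fin 2)).measurable.comp (measurable_pi_lambda _ fun i =>
    measurable_subtype_coe.comp
      ((AddCircle.measurableEquivIoc (1 : ℝ) (-1 / 2)).measurable.comp (measurable_pi_apply i)))

lemma toTorus_rep (x : T2) : toTorus (rep x) = x := funext fun _ => AddCircle.coe_equivIoc

lemma integral_comp_rep {E : Type*} [NormedAddCommGroup E] [NormedSpace ℝ E] (h : Plane → E)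
    (hh : ∀ y : Plane, (¬ ∀ i, y i ∈ Set.Ioc (-1 / 2 : ℝ) (1 / 2)) → h y = 0) :
    ∫ x, h (rep x) ∂torusMeasure = ∫ y, h y := by
  have h1 := integral_preimage (fun x : T2 => h (rep x)) (fun _ => (-1 / 2 : ℝ))
  refine Eq.trans h1 ?_
  have hset : {x : Fin 2 → ℝ | ∀ i, x i ∈ Set.Ioc (-1 / 2 : ℝ) (-1 / 2 + 1)} =
      {x : Fin 2 → ℝ | ∀ i, x i ∈ Set.Ioc (-1 / 2 : ℝ) (1 / 2)} := by norm_num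
  rw [hset]
  have h2 : ∫ x in {x : Fin 2 → ℝ | ∀ i, x i ∈ Set.Ioc (-1 / 2 : ℝ) (1 / 2)},
      h (rep fun i => (x i : UnitAddCircle)) =
      ∫ x in {x : Fin 2 → ℝ | ∀ i, x i ∈ Set.Ioc (-1 / 2 : ℝ) (1 / 2)}, h (WithLp.toLp 2 x) := by
    refine setIntegral_congr_fun (MeasurableSet.univ_pi' fun i => measurableSet_Ioc) fun x hx => ?_
    simp only
    congr 1
    ext i
    have hi := hx i
    exact AddCircle.equivIoc_coe_of_mem (by norm_num at hi ⊢; exact hi)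
  rw [h2, setIntegral_eq_integral_of_forall_compl_eq_zero]
  · exact (PiLp.volume_preserving_toLp (Fin 2)).integral_comp
      (MeasurableEquiv.toLp 2 (Fin 2 → ℝ)).measurableEmbedding h
  · intro x hx
    exact hh _ hx

/-- The Fourier transform of a radial density. -/
def cosTransform (φ : Plane → ℝ) (a b : ℝ) : ℝ :=
  ∫ y, φ y * Real.cos (2 * Real.pi * (a * y 0 + b * y 1))

namespace IsRadialDensity

variable {φ : Plane → ℝ} (hφ : IsRadialDensity φ)
include hφ

lemma integrable : Integrable φ := hφ.continuous.integrable_of_hasCompactSupport hφ.hasCompactSupport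

lemma eq_zero_of_not_mem {y : Plane} (hy : ¬ ∀ i, y i ∈ Set.Ioo (-1 / 2 : ℝ) (1 / 2)) : φ y = 0 :=
  image_eq_zero_of_notMem_tsupport fun h => hy (hφ.tsupport_subset h)

lemma integrable_mul {g : Plane → ℝ} (hg : Continuous g) : Integrable fun y => φ y * g y :=
  (hφ.continuous.mul hg).integrable_of_hasCompactSupport hφ.hasCompactSupport.mul_right

/-- Source of all the symmetries below: `φ` and Lebesgue measure are invariant under linear
isometries. -/
lemma integral_mul_comp (e : Plane ≃ₗᵢ[ℝ] Plane) (g : Plane → ℝ) :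
    ∫ y, φ y * g (e y) = ∫ y, φ y * g y := by
  have h : ∀ y, φ y * g (e y) = φ (e y) * g (e y) := fun y => by
    rw [hφ.radial y (e y) (e.norm_map y).symm]
  simp only [h]
  exact e.measurePreserving.integral_comp e.toHomeomorph.measurableEmbedding fun y => φ y * g y

lemma cosTransform_swap (a b : ℝ) : cosTransform φ b a = cosTransform φ a b := by
  have := hφ.integral_mul_comp (LinearIsometryEquiv.piLpCongrLeft 2 ℝ ℝ (Equiv.swap (0 : Fin 2) 1))
    fun y => Real.cos (2 * Real.pi * (a * y 0 + b * y 1))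
  rw [cosTransform, cosTransform, ← this]
  simp [add_comm]

lemma cosTransform_neg_left (a b : ℝ) : cosTransform φ (-a) b = cosTransform φ a b := by
  have := hφ.integral_mul_comp (LinearIsometryEquiv.piLpCongrRight 2
      fun i : Fin 2 => if i = 0 then LinearIsometryEquiv.neg ℝ else LinearIsometryEquiv.refl ℝ ℝ)
    fun y => Real.cos (2 * Real.pi * (a * y 0 + b * y 1))
  rw [cosTransform, cosTransform, ← this]
  simp

lemma integral_mul_sin (a b : ℝ) :
    ∫ y, φ y * Real.sin (2 * Real.pi * (a * y 0 + b * y 1)) = 0 := by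
  have := hφ.integral_mul_comp (LinearIsometryEquiv.neg ℝ)
    fun y => Real.sin (2 * Real.pi * (a * y 0 + b * y 1))
  have e : ∀ y : Plane, φ y * Real.sin (2 * Real.pi * (a * (-y) 0 + b * (-y) 1)) =
      -(φ y * Real.sin (2 * Real.pi * (a * y 0 + b * y 1))) := fun y => by
    rw [← mul_neg, ← Real.sin_neg]
    congr 2
    simp; ring
  simp only [LinearIsometryEquiv.coe_neg, e, integral_neg] at this
  linarith

lemma cosTransform_zero : cosTransform φ 0 0 = 1 := by
  simp [cosTransform, hφ.integral_eq_one]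

lemma abs_cosTransform_le (a b : ℝ) : |cosTransform φ a b| ≤ 1 := by
  rw [← hφ.integral_eq_one]
  refine (abs_integral_le_integral_abs).trans (integral_mono (hφ.integrable_mul (by fun_prop)).abs
    hφ.integrable fun y => ?_)
  simp only [abs_mul, abs_of_nonneg (hφ.nonneg y)]
  exact mul_le_of_le_one_right (hφ.nonneg y) (Real.abs_cos_le_one _)

/-- From `1 - cos t ≤ t²/2` and `|y|² ≤ 1/2` on the support, with `π² ≤ 10`. -/
lemma one_sub_cosTransform_le (a b : ℝ) : 1 - cosTransform φ a b ≤ 10 * (a ^ 2 + b ^ 2) := by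
  have h1 : 1 - cosTransform φ a b =
      ∫ y, (φ y - φ y * Real.cos (2 * Real.pi * (a * y 0 + b * y 1))) := by
    rw [integral_sub hφ.integrable (hφ.integrable_mul (by fun_prop)), hφ.integral_eq_one]
    rfl
  have h2 : 10 * (a ^ 2 + b ^ 2) = ∫ y, φ y * (10 * (a ^ 2 + b ^ 2)) := by
    rw [integral_mul_const, hφ.integral_eq_one, one_mul]
  rw [h1, h2]
  refine integral_mono (hφ.integrable.sub (hφ.integrable_mul (by fun_prop)))
    (hφ.integrable.mul_const _) fun y => ?_
  simp only
  by_cases hy : ∀ i, y i ∈ Set.Ioo (-1 / 2 : ℝ) (1 / 2)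
  · rw [← mul_one_sub]
    refine mul_le_mul_of_nonneg_left ?_ (hφ.nonneg y)
    have hc := Real.one_sub_sq_div_two_le_cos (x := 2 * Real.pi * (a * y 0 + b * y 1))
    have h0 := hy 0
    have h1 := hy 1
    have e0 : (y 0) ^ 2 ≤ 1 / 4 := by nlinarith [h0.1, h0.2]
    have e1 : (y 1) ^ 2 ≤ 1 / 4 := by nlinarith [h1.1, h1.2]
    have hcs : (a * y 0 + b * y 1) ^ 2 ≤ (a ^ 2 + b ^ 2) * (1 / 2) := by
      calc (a * y 0 + b * y 1) ^ 2 ≤ (a ^ 2 + b ^ 2) * (y 0 ^ 2 + y 1 ^ 2) := by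
            nlinarith [sq_nonneg (a * y 1 - b * y 0)]
        _ ≤ _ := by gcongr; linarith
    have hpi : Real.pi ^ 2 ≤ 10 := by nlinarith [Real.pi_lt_d2, Real.pi_pos]
    have : (2 * Real.pi * (a * y 0 + b * y 1)) ^ 2 / 2 ≤ 10 * (a ^ 2 + b ^ 2) := by
      calc (2 * Real.pi * (a * y 0 + b * y 1)) ^ 2 / 2
          = Real.pi ^ 2 * (2 * (a * y 0 + b * y 1) ^ 2) := by ring
        _ ≤ 10 * (2 * ((a ^ 2 + b ^ 2) * (1 / 2))) := by gcongr
        _ = _ := by ring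
    linarith
  · simp [hφ.eq_zero_of_not_mem hy]

lemma measurable_rescale (ℓ : ℝ) : Measurable (rescale φ ℓ) :=
  (hφ.continuous.measurable.comp ((measurable_const_smul ℓ⁻¹).comp measurable_rep)).const_mul _

lemma exists_abs_rescale_le : ∃ M, 0 ≤ M ∧ ∀ ℓ x, |rescale φ ℓ x| ≤ (ℓ ^ 2)⁻¹ * M := by
  obtain ⟨M, hM⟩ := hφ.hasCompactSupport.exists_bound_of_continuous hφ.continuous
  refine ⟨M, (norm_nonneg _).trans (hM 0), fun ℓ x => ?_⟩
  rw [rescale, abs_mul, abs_of_nonneg (by positivity)]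
  exact mul_le_mul_of_nonneg_left (hM _) (by positivity)

lemma rescale_nonneg (ℓ : ℝ) (x : T2) : 0 ≤ rescale φ ℓ x :=
  mul_nonneg (by positivity) (hφ.nonneg _)

/-- For `ℓ < 1` the rescaled support stays in the fundamental cell, so the coefficient is an
integral over the plane. Its sine part vanishes under `y ↦ -y`. -/
lemma coeff_rescale {ℓ : ℝ} (hℓ : 0 < ℓ) (hℓ1 : ℓ < 1) (k : Fin 2 → ℤ) :
    coeff (fun x => (rescale φ ℓ x : ℂ)) k = cosTransform φ (ℓ * k 0) (ℓ * k 1) := by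
  let f : Plane → ℂ := fun y => φ y *
    Complex.exp (-(2 * Real.pi * (ℓ * k 0 * y 0 + ℓ * k 1 * y 1) : ℝ) * Complex.I)
  let h : Plane → ℂ := fun y => ((ℓ ^ 2)⁻¹ : ℝ) * f (ℓ⁻¹ • y)
  have e1 : ∀ x : T2, mFourier (-k) x * (rescale φ ℓ x : ℂ) = h (rep x) := fun x => by
    conv_lhs => rw [← toTorus_rep x, mFourier_toTorus, toTorus_rep]
    simp only [h, f, rescale]
    push_cast
    rw [mul_comm, mul_assoc]
    congr 3
    have hℓ' : (ℓ : ℂ) ≠ 0 := by exact_mod_cast hℓ.ne'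
    simp
    field_simp
    ring
  have e2 : ∫ x, h (rep x) ∂torusMeasure = ∫ y, h y := by
    refine integral_comp_rep h fun y hy => ?_
    have : φ (ℓ⁻¹ • y) = 0 := hφ.eq_zero_of_not_mem fun hi => hy fun i => by
      have h1 := hi i
      simp only [PiLp.smul_apply, smul_eq_mul, Set.mem_Ioo, inv_mul_eq_div] at h1
      rw [lt_div_iff₀ hℓ, div_lt_iff₀ hℓ] at h1
      constructor <;> linarith
    simp [h, f, this]
  have e3 : ∫ y, h y = ∫ y, f y := by
    simp only [h, integral_const_mul]
    rw [Measure.integral_comp_inv_smul]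
    have : Module.finrank ℝ Plane = 2 := by simp
    rw [this, abs_of_pos (by positivity), Complex.real_smul, ← mul_assoc, ← Complex.ofReal_mul,
      inv_mul_cancel₀ (by positivity)]
    simp
  have e4 : ∀ y, f y = ((φ y * Real.cos (2 * Real.pi * (ℓ * k 0 * y 0 + ℓ * k 1 * y 1)) : ℝ) : ℂ) -
      ((φ y * Real.sin (2 * Real.pi * (ℓ * k 0 * y 0 + ℓ * k 1 * y 1)) : ℝ) : ℂ) * Complex.I := by
    intro y
    simp only [f]
    rw [← Complex.ofReal_neg, Complex.exp_mul_I, ← Complex.ofReal_cos, ← Complex.ofReal_sin,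
      Real.cos_neg, Real.sin_neg]
    push_cast
    ring
  simp only [coeff, e1]
  rw [e2, e3]
  simp only [e4]
  rw [integral_sub (hφ.integrable_mul (by fun_prop)).ofReal
    ((hφ.integrable_mul (by fun_prop)).ofReal.mul_const _), integral_mul_const,
    integral_complex_ofReal, integral_complex_ofReal, hφ.integral_mul_sin]
  simp [cosTransform]

lemma memLp_rescale (ℓ : ℝ) (p : ENNReal) :
    MemLp (fun x => (rescale φ ℓ x : ℂ)) p torusMeasure := by
  obtain ⟨M, hM0, hM⟩ := hφ.exists_abs_rescale_le
  refine MemLp.of_bound (by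
    have := hφ.measurable_rescale ℓ
    fun_prop) ((ℓ ^ 2)⁻¹ * M) (ae_of_all _ fun x => ?_)
  rw [Complex.norm_real]
  exact hM ℓ x

/-- Parseval together with `∫ φ_ℓ² ≤ sup φ_ℓ · ∫ φ_ℓ`, where `∫ φ_ℓ = 1`. -/
lemma exists_tsum_cosTransform_sq_le : ∃ M, ∀ ℓ, 0 < ℓ → ℓ < 1 →
    Summable (fun k : Fin 2 → ℤ => cosTransform φ (ℓ * k 0) (ℓ * k 1) ^ 2) ∧
    ∑' k : Fin 2 → ℤ, cosTransform φ (ℓ * k 0) (ℓ * k 1) ^ 2 ≤ (ℓ ^ 2)⁻¹ * M := by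
  obtain ⟨M, hM0, hM⟩ := hφ.exists_abs_rescale_le
  refine ⟨M, fun ℓ hℓ hℓ1 => ?_⟩
  have h := hasSum_sq_norm_coeff (hφ.memLp_rescale ℓ 2)
  simp only [hφ.coeff_rescale hℓ hℓ1, Complex.norm_real, Real.norm_eq_abs, sq_abs] at h
  refine ⟨h.summable, ?_⟩
  rw [h.tsum_eq]
  have hi : Integrable (rescale φ ℓ) torusMeasure := by
    simpa using (memLp_one_iff_integrable.1 (hφ.memLp_rescale ℓ 1)).re
  have h1 : ∫ x, rescale φ ℓ x ∂torusMeasure = 1 := by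
    have := hφ.coeff_rescale hℓ hℓ1 0
    simp only [coeff, neg_zero, mFourier_zero, ContinuousMap.one_apply, one_mul, Pi.zero_apply,
      Int.cast_zero, mul_zero, hφ.cosTransform_zero, integral_complex_ofReal] at this
    exact_mod_cast this
  calc ∫ x, rescale φ ℓ x ^ 2 ∂torusMeasure
      ≤ ∫ x, (ℓ ^ 2)⁻¹ * M * rescale φ ℓ x ∂torusMeasure := by
        refine integral_mono_of_nonneg (ae_of_all _ fun x => by positivity) (hi.const_mul _)
          (ae_of_all _ fun x => ?_)
        simp only [pow_two (rescale φ ℓ x)]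
        exact mul_le_mul_of_nonneg_right ((le_abs_self _).trans (hM ℓ x)) (hφ.rescale_nonneg ℓ x)
    _ = _ := by rw [integral_const_mul, h1, mul_one]

end IsRadialDensity

/-! ### Convolutions and the pairing as a lattice sum. -/

instance : torusMeasure.IsNegInvariant := by
  have : (AddCircle.haarAddCircle (T := (1 : ℝ))).IsNegInvariant :=
    Measure.IsAddHaarMeasure.isNegInvariant_of_regular _
  infer_instance

lemma coeff_conv {F g : T2 → ℝ} (hF : Integrable F torusMeasure) (hg : Integrable g torusMeasure)
    (k : Fin 2 → ℤ) :
    coeff (fun x => ((conv F g x : ℝ) : ℂ)) k =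
      coeff (fun x => (F x : ℂ)) k * coeff (fun x => (g x : ℂ)) k := by
  have h1 := integrable_mFourier_mul hg.ofReal (-k)
  have h2 := integrable_mFourier_mul hF.ofReal (-k)
  have h := integral_convolution (ContinuousLinearMap.mul ℝ ℂ) h1 h2
  -- Characters are multiplicative, so twisting both factors by one twists their convolution.
  have e : ∀ x, convolution (fun x => mFourier (-k) x * (g x : ℂ))
      (fun x => mFourier (-k) x * (F x : ℂ)) (ContinuousLinearMap.mul ℝ ℂ) torusMeasure x =
      mFourier (-k) x * ((conv F g x : ℝ) : ℂ) := fun x => by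
    rw [convolution_def, conv, convolution_def, ← integral_complex_ofReal, ← integral_const_mul]
    refine integral_congr_ae (ae_of_all _ fun t => ?_)
    simp only [ContinuousLinearMap.mul_apply', ContinuousLinearMap.lsmul_apply, smul_eq_mul,
      Complex.ofReal_mul]
    have : mFourier (-k) x = mFourier (-k) t * mFourier (-k) (x - t) := by
      rw [← mFourier_add_apply, add_sub_cancel]
    rw [this]
    ring
  rw [coeff, coeff, coeff, mul_comm, ← funext e]
  exact h

/-- An integrable function convolved with a bounded one is bounded, so Parseval applies although the
gradient is only in `L¹`. -/
lemma memLp_conv {F g : T2 → ℝ} (hF : Integrable F torusMeasure) (hg : Integrable g torusMeasure)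
    {M : ℝ} (hM : ∀ x, |g x| ≤ M) :
    MemLp (fun x => ((conv F g x : ℝ) : ℂ)) 2 torusMeasure := by
  have hm : AEStronglyMeasurable (conv F g) torusMeasure :=
    (hg.integrable_convolution (ContinuousLinearMap.lsmul ℝ ℝ) hF).aestronglyMeasurable
  refine MemLp.of_bound (by fun_prop) (M * ∫ x, |F x| ∂torusMeasure) (ae_of_all _ fun x => ?_)
  rw [Complex.norm_real, conv, convolution_def]
  have e : ∫ t, |F (x - t)| ∂torusMeasure = ∫ t, |F t| ∂torusMeasure :=
    integral_sub_left_eq_self (fun t => |F t|) torusMeasure x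
  rw [← e, ← integral_const_mul]
  refine norm_integral_le_of_norm_le ((hF.comp_sub_left x).abs.const_mul M) (ae_of_all _ fun t => ?_)
  simp only [ContinuousLinearMap.lsmul_apply, smul_eq_mul, norm_mul, Real.norm_eq_abs]
  gcongr
  exact hM t

lemma hasSum_pairing {u v : T2 → ℝ} (hu : MemLp (fun x => (u x : ℂ)) 2 torusMeasure)
    (hv : MemLp (fun x => (v x : ℂ)) 2 torusMeasure) :
    HasSum (fun k => conj (coeff (fun x => (u x : ℂ)) k) * coeff (fun x => (v x : ℂ)) k)
      (pairing u v : ℂ) := by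
  have h := hasSum_conj_coeff_mul_coeff hu hv
  convert! h using 1
  rw [pairing, ← integral_complex_ofReal]
  simp

/-- The product `φ̂(ℓk) ψ̂(ℓk)`. -/
def transformProd (φ ψ : Plane → ℝ) (ℓ : ℝ) (k : Fin 2 → ℤ) : ℝ :=
  cosTransform φ (ℓ * k 0) (ℓ * k 1) * cosTransform ψ (ℓ * k 0) (ℓ * k 1)

lemma IsRadialDensity.integrable_rescale {φ : Plane → ℝ} (hφ : IsRadialDensity φ) (ℓ : ℝ) :
    Integrable (rescale φ ℓ) torusMeasure := by
  simpa using (memLp_one_iff_integrable.1 (hφ.memLp_rescale ℓ 1)).re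

section Gradient

variable {G : T2 → ℝ} {DG : Fin 2 → T2 → ℝ} (hG : IsGreenFunction G)
  (hD : ∀ i, IsWeakPartialDeriv i G (DG i)) {φ ψ : Plane → ℝ} (hφ : IsRadialDensity φ)
  (hψ : IsRadialDensity ψ) {ℓ : ℝ} (hℓ : 0 < ℓ) (hℓ1 : ℓ < 1)
include hG hD hφ hψ hℓ hℓ1

lemma hasSum_pairing_conv (i j : Fin 2) :
    HasSum (fun k : Fin 2 → ℤ => (k i * k j : ℝ) / (4 * Real.pi ^ 2 * normSq k ^ 2) *
      transformProd φ ψ ℓ k)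
      (pairing (conv (DG i) (rescale φ ℓ)) (conv (DG j) (rescale ψ ℓ))) := by
  obtain ⟨M, -, hM⟩ := hφ.exists_abs_rescale_le
  obtain ⟨M', -, hM'⟩ := hψ.exists_abs_rescale_le
  have h := hasSum_pairing (memLp_conv (hD i).integrable (hφ.integrable_rescale ℓ) (hM ℓ))
    (memLp_conv (hD j).integrable (hψ.integrable_rescale ℓ) (hM' ℓ))
  simp only [coeff_conv (hD _).integrable (hφ.integrable_rescale ℓ),
    coeff_conv (hD _).integrable (hψ.integrable_rescale ℓ), hφ.coeff_rescale hℓ hℓ1,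
    hψ.coeff_rescale hℓ hℓ1, (hD _).coeff_eq hG] at h
  refine Complex.hasSum_ofReal.1 (h.congr_fun fun k => ?_)
  simp only [gradCoeff, transformProd, map_mul, map_div₀, Complex.conj_I, Complex.conj_ofReal,
    map_intCast, map_ofNat]
  push_cast
  rcases eq_or_ne k 0 with rfl | hk
  · simp
  · have a1 : (normSq k : ℂ) ≠ 0 := by exact_mod_cast (normSq_pos hk).ne'
    have a2 : (Real.pi : ℂ) ≠ 0 := by exact_mod_cast Real.pi_ne_zero
    field_simp
    linear_combination (4 * (k i : ℂ) * k j * cosTransform φ (ℓ * k 0) (ℓ * k 1) *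
      cosTransform ψ (ℓ * k 0) (ℓ * k 1)) * Complex.I_sq

lemma pairing_conv_eq_zero {i j : Fin 2} (hij : i ≠ j) :
    pairing (conv (DG i) (rescale φ ℓ)) (conv (DG j) (rescale ψ ℓ)) = 0 := by
  have h := hasSum_pairing_conv hG hD hφ hψ hℓ hℓ1 i j
  -- The reflection `k₀ ↦ -k₀` flips the sign of `kᵢkⱼ` and fixes every other factor.
  let e : (Fin 2 → ℤ) ≃ (Fin 2 → ℤ) :=
    Equiv.piCongrRight fun i => if i = 0 then Equiv.neg ℤ else Equiv.refl ℤ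
  have h2 := (e.hasSum_iff.2 h).neg
  have h3 := h.unique (h2.congr_fun fun k => ?_)
  · linarith
  · have e0 : e k 0 = -k 0 := by simp [e]
    have e1 : e k 1 = k 1 := by simp [e]
    have e2 : normSq (e k) = normSq k := by simp [normSq, e0, e1]
    have e3 : ((e k i : ℝ) * e k j) = -(k i * k j) := by
      fin_cases i <;> fin_cases j <;> simp_all
    simp only [Function.comp, e2, e3, transformProd, e0, e1, Int.cast_neg, mul_neg,
      hφ.cosTransform_neg_left, hψ.cosTransform_neg_left]
    ring

lemma hasSum_two_mul_pairing_conv (i : Fin 2) :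
    HasSum (fun k : Fin 2 → ℤ => (4 * Real.pi ^ 2)⁻¹ * ((normSq k)⁻¹ * transformProd φ ψ ℓ k))
      (2 * pairing (conv (DG i) (rescale φ ℓ)) (conv (DG i) (rescale ψ ℓ))) := by
  have h := hasSum_pairing_conv hG hD hφ hψ hℓ hℓ1 i i
  -- Adding the sum reindexed by the coordinate swap turns `kᵢ²` into `|k|²`.
  let e : (Fin 2 → ℤ) ≃ (Fin 2 → ℤ) := Equiv.arrowCongr (Equiv.swap 0 1) (Equiv.refl ℤ)
  have h2 := h.add (e.hasSum_iff.2 h)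
  rw [← two_mul] at h2
  refine h2.congr_fun fun k => ?_
  have e0 : e k 0 = k 1 := by simp [e]
  have e1 : e k 1 = k 0 := by simp [e]
  have e2 : normSq (e k) = normSq k := by simp [normSq, e0, e1, add_comm]
  have e3 : ((k i : ℝ) * k i) + (e k i : ℝ) * e k i = normSq k := by
    fin_cases i <;> simp [e0, e1, normSq] <;> ring
  simp only [Function.comp, e2, transformProd, e0, e1]
  rw [hφ.cosTransform_swap (ℓ * k 0), hψ.cosTransform_swap (ℓ * k 0), ← add_mul, ← add_div, e3]
  rcases eq_or_ne k 0 with rfl | hk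
  · simp
  · have := (normSq_pos hk).ne'
    field_simp

end Gradient

/-! ### Logarithmic asymptotics of the weighted lattice sum. -/

lemma abs_transformProd_le (φ ψ : Plane → ℝ)
    (ℓ : ℝ) (k : Fin 2 → ℤ) : |transformProd φ ψ ℓ k| ≤
      (cosTransform φ (ℓ * k 0) (ℓ * k 1) ^ 2 + cosTransform ψ (ℓ * k 0) (ℓ * k 1) ^ 2) / 2 := by
  rw [transformProd, abs_le]
  constructor <;> nlinarith [sq_nonneg (cosTransform φ (ℓ * k 0) (ℓ * k 1) +
    cosTransform ψ (ℓ * k 0) (ℓ * k 1)), sq_nonneg (cosTransform φ (ℓ * k 0) (ℓ * k 1) -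
    cosTransform ψ (ℓ * k 0) (ℓ * k 1))]

lemma abs_transformProd_sub_one_le {φ ψ : Plane → ℝ} (hφ : IsRadialDensity φ)
    (hψ : IsRadialDensity ψ) (ℓ : ℝ) (k : Fin 2 → ℤ) :
    |transformProd φ ψ ℓ k - 1| ≤ 20 * (ℓ ^ 2 * normSq k) := by
  have h1 := hφ.one_sub_cosTransform_le (ℓ * k 0) (ℓ * k 1)
  have h2 := hψ.one_sub_cosTransform_le (ℓ * k 0) (ℓ * k 1)
  have a1 := abs_le.1 (hφ.abs_cosTransform_le (ℓ * k 0) (ℓ * k 1))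
  have a2 := abs_le.1 (hψ.abs_cosTransform_le (ℓ * k 0) (ℓ * k 1))
  have e : ℓ ^ 2 * normSq k = (ℓ * k 0) ^ 2 + (ℓ * k 1) ^ 2 := by unfold normSq; ring
  rw [e, transformProd]
  set x := cosTransform φ (ℓ * k 0) (ℓ * k 1)
  set y := cosTransform ψ (ℓ * k 0) (ℓ * k 1)
  rw [abs_le]
  constructor <;> nlinarith

/-- The box `|k|_∞ ≤ N`. -/
def box (N : ℕ) : Finset (Fin 2 → ℤ) := Fintype.piFinset fun _ => Finset.Icc (-(N : ℤ)) N

lemma card_box (N : ℕ) : ((box N).card : ℝ) = (2 * N + 1) ^ 2 := by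
  have : (Finset.Icc (-(N : ℤ)) N).card = 2 * N + 1 := by simp; omega
  rw [box, Fintype.card_piFinset]
  simp only [this]
  simp

lemma sum_box (N : ℕ) : ∑ k ∈ box N, (normSq k)⁻¹ = boxSum N := by
  rw [boxSum, ← Finset.sum_product']
  refine Finset.sum_bij' (fun k _ => (k 0, k 1)) (fun p _ => ![p.1, p.2]) ?_ ?_ ?_ ?_ ?_
  · intro k hk
    have := Fintype.mem_piFinset.1 hk
    exact Finset.mem_product.2 ⟨this 0, this 1⟩
  · intro p hp
    have := Finset.mem_product.1 hp
    refine Fintype.mem_piFinset.2 fun i => ?_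
    fin_cases i
    · exact this.1
    · exact this.2
  · intro k _
    ext i; fin_cases i <;> rfl
  · intro p _; rfl
  · intro k _; rfl

lemma le_normSq_of_not_mem_box {N : ℕ} {k : Fin 2 → ℤ} (hk : k ∉ box N) :
    ((N : ℝ) + 1) ^ 2 ≤ normSq k := by
  simp only [box, Fintype.mem_piFinset, not_forall] at hk
  obtain ⟨i, hi⟩ := hk
  have h1 : (N : ℤ) + 1 ≤ |k i| := by
    by_contra! h
    exact hi (Finset.mem_Icc.2 (abs_le.1 (by omega)))
  have h2 : (N : ℝ) + 1 ≤ |(k i : ℝ)| := by exact_mod_cast h1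
  have h3 : ((N : ℝ) + 1) ^ 2 ≤ (k i : ℝ) ^ 2 := by
    rw [← sq_abs (k i : ℝ)]; gcongr
  refine h3.trans ?_
  unfold normSq
  fin_cases i <;> simp <;> positivity

/-- The logarithmic asymptotics of the lattice sum. -/
lemma exists_abs_tsum_sub_log_le {φ ψ : Plane → ℝ} (hφ : IsRadialDensity φ)
    (hψ : IsRadialDensity ψ) : ∃ C, ∀ ℓ, 0 < ℓ → ℓ < 1 → ∀ S,
      HasSum (fun k => (normSq k)⁻¹ * transformProd φ ψ ℓ k) S →
      |S - 2 * Real.pi * Real.log ℓ⁻¹| ≤ C := by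
  obtain ⟨M, hM⟩ := hφ.exists_tsum_cosTransform_sq_le
  obtain ⟨M', hM'⟩ := hψ.exists_tsum_cosTransform_sq_le
  -- In order: replacing the weight by `1` in the box, the tail, the box sum, and `2π |log N - log
  -- ℓ⁻¹| ≤ 8`.
  refine ⟨180 + (M + M') / 2 + 16 + 8, fun ℓ hℓ hℓ1 S hS => ?_⟩
  obtain ⟨hs1, ht1⟩ := hM ℓ hℓ hℓ1
  obtain ⟨hs2, ht2⟩ := hM' ℓ hℓ hℓ1
  have hinv : 1 < ℓ⁻¹ := (one_lt_inv₀ hℓ).2 hℓ1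
  set N := ⌊ℓ⁻¹⌋₊ with hN
  have hNle : (N : ℝ) ≤ ℓ⁻¹ := Nat.floor_le (by positivity)
  have hNlt : ℓ⁻¹ < N + 1 := Nat.lt_floor_add_one _
  have hN1 : 1 ≤ N := Nat.le_floor (by simpa using hinv.le)
  have hN1' : (1 : ℝ) ≤ N := by exact_mod_cast hN1
  have hbox : |∑ k ∈ box N, (normSq k)⁻¹ * transformProd φ ψ ℓ k - boxSum N| ≤ 180 := by
    rw [← sum_box, ← Finset.sum_sub_distrib]
    refine (Finset.abs_sum_le_sum_abs _ _).trans ?_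
    -- The quadratic error of the weight cancels `|k|⁻²`, leaving `20ℓ²` for each of at most
    -- `(3/ℓ)²` points.
    have hterm : ∀ k ∈ box N, |(normSq k)⁻¹ * transformProd φ ψ ℓ k - (normSq k)⁻¹| ≤ 20 * ℓ ^ 2 := by
      intro k _
      rw [← mul_sub_one, abs_mul, abs_of_nonneg (inv_nonneg.2 (normSq_nonneg k))]
      rcases eq_or_ne k 0 with rfl | hk
      · simp; positivity
      · have hp := normSq_pos hk
        rw [inv_mul_le_iff₀ hp]
        exact (abs_transformProd_sub_one_le hφ hψ ℓ k).trans_eq (by ring)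
    refine (Finset.sum_le_card_nsmul _ _ _ hterm).trans ?_
    rw [nsmul_eq_mul, card_box]
    have h3 : ℓ * (2 * N + 1) ≤ 3 := by
      calc ℓ * (2 * N + 1) ≤ ℓ * (3 * ℓ⁻¹) := by gcongr; linarith
        _ = 3 := by field_simp
    calc (2 * (N : ℝ) + 1) ^ 2 * (20 * ℓ ^ 2) = 20 * (ℓ * (2 * N + 1)) ^ 2 := by ring
      _ ≤ 20 * 3 ^ 2 := by gcongr
      _ = 180 := by norm_num
  -- Outside the box `|k|⁻² ≤ ℓ²`, which offsets the `ℓ⁻²` in the Parseval bound for the transforms.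
  have htail : |S - ∑ k ∈ box N, (normSq k)⁻¹ * transformProd φ ψ ℓ k| ≤ (M + M') / 2 := by
    set w : (Fin 2 → ℤ) → ℝ := fun k => (normSq k)⁻¹ * transformProd φ ψ ℓ k with hw
    have h1 : HasSum (fun k => if k ∈ box N then w k else 0) (∑ k ∈ box N, w k) := by
      have : HasSum (fun k => if k ∈ box N then w k else 0)
          (∑ k ∈ box N, if k ∈ box N then w k else 0) :=
        hasSum_sum_of_ne_finset_zero fun k hk => by simp [hk]
      rwa [Finset.sum_congr rfl fun k hk => if_pos hk] at this
    have h2 := hS.sub h1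
    have h3 := ((hs1.hasSum.add hs2.hasSum).div_const 2).mul_left (ℓ ^ 2)
    rw [← h2.tsum_eq, ← Real.norm_eq_abs]
    refine (tsum_of_norm_bounded h3 fun k => ?_).trans ?_
    · by_cases hk : k ∈ box N
      · simp only [hk, if_true, hw, sub_self, norm_zero]
        positivity
      · simp only [hk, if_false, sub_zero, Real.norm_eq_abs]
        rw [abs_mul, abs_of_nonneg (inv_nonneg.2 (normSq_nonneg k))]
        have h4 := le_normSq_of_not_mem_box hk
        have h5 : (normSq k)⁻¹ ≤ ℓ ^ 2 := by
          rw [inv_le_comm₀ (lt_of_lt_of_le (by positivity) h4) (by positivity), ← inv_pow]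
          refine le_trans ?_ h4
          gcongr
        gcongr
        exact abs_transformProd_le φ ψ ℓ k
    · calc _ ≤ ℓ ^ 2 * (((ℓ ^ 2)⁻¹ * M + (ℓ ^ 2)⁻¹ * M') / 2) := by gcongr
        _ = _ := by field_simp
  have hlog : |Real.log N - Real.log ℓ⁻¹| ≤ 1 := by
    have h1 : Real.log N ≤ Real.log ℓ⁻¹ := by gcongr
    have h2 : Real.log ℓ⁻¹ ≤ Real.log (2 * N) := by gcongr; linarith
    rw [Real.log_mul (by norm_num) (by positivity)] at h2
    have := Real.log_two_lt_d9
    rw [abs_le]; constructor <;> linarith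
  have hB := abs_boxSum_sub_log_le hN1
  have hpi4 := Real.pi_lt_four
  have hpi := Real.pi_pos
  rw [abs_le] at *
  constructor <;> nlinarith

/-! ### The two limits. -/

lemma tendsto_log_inv : Tendsto (fun ℓ : ℝ => Real.log ℓ⁻¹) (𝓝[>] 0) atTop :=
  Real.tendsto_log_atTop.comp tendsto_inv_nhdsGT_zero

lemma eventually_mem_Ioo : ∀ᶠ ℓ : ℝ in 𝓝[>] 0, 0 < ℓ ∧ ℓ < 1 :=
  Ioo_mem_nhdsGT one_pos

lemma tendsto_pairing_div_log {G : T2 → ℝ} {DG : Fin 2 → T2 → ℝ} (hG : IsGreenFunction G)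
    (hD : ∀ i, IsWeakPartialDeriv i G (DG i)) {φ ψ : Plane → ℝ} (hφ : IsRadialDensity φ)
    (hψ : IsRadialDensity ψ) (i j : Fin 2) :
    Tendsto (fun ℓ : ℝ => pairing (conv (DG i) (rescale φ ℓ)) (conv (DG j) (rescale ψ ℓ)) /
      Real.log ℓ⁻¹) (𝓝[>] 0) (𝓝 (1 / (4 * Real.pi) * if i = j then 1 else 0)) := by
  by_cases hij : i = j
  · subst hij
    obtain ⟨C, hC⟩ := exists_abs_tsum_sub_log_le hφ hψ
    set P : ℝ → ℝ := fun ℓ => pairing (conv (DG i) (rescale φ ℓ)) (conv (DG i) (rescale ψ ℓ))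
    have hP : ∀ᶠ ℓ : ℝ in 𝓝[>] 0, |8 * Real.pi ^ 2 * P ℓ - 2 * Real.pi * Real.log ℓ⁻¹| ≤ C := by
      filter_upwards [eventually_mem_Ioo] with ℓ hℓ
      refine hC ℓ hℓ.1 hℓ.2 _ ?_
      have h := (hasSum_two_mul_pairing_conv hG hD hφ hψ hℓ.1 hℓ.2 i).mul_left (4 * Real.pi ^ 2)
      simp only [mul_inv_cancel_left₀ (show (4 * Real.pi ^ 2) ≠ 0 by positivity)] at h
      convert! h using 1
      simp only [P]
      ring
    have h0 : Tendsto (fun ℓ : ℝ => (8 * Real.pi ^ 2 * P ℓ - 2 * Real.pi * Real.log ℓ⁻¹) /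
        Real.log ℓ⁻¹) (𝓝[>] 0) (𝓝 0) := by
      have h1 : Tendsto (fun ℓ : ℝ => C / Real.log ℓ⁻¹) (𝓝[>] 0) (𝓝 0) :=
        tendsto_log_inv.const_div_atTop C
      refine squeeze_zero_norm' ?_ h1
      filter_upwards [hP, tendsto_log_inv.eventually_gt_atTop 0] with ℓ h2 h3
      rw [norm_div, Real.norm_eq_abs, Real.norm_of_nonneg h3.le]
      gcongr
    have h1 := (h0.add_const (2 * Real.pi)).div_const (8 * Real.pi ^ 2)
    rw [if_pos rfl, mul_one]
    have e : (0 + 2 * Real.pi) / (8 * Real.pi ^ 2) = 1 / (4 * Real.pi) := by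
      field_simp; ring
    rw [e] at h1
    refine h1.congr' ?_
    filter_upwards [tendsto_log_inv.eventually_gt_atTop 0] with ℓ h3
    have hpi := Real.pi_ne_zero
    have h4 := h3.ne'
    simp only [P]
    generalize Real.log ℓ⁻¹ = L at h4 ⊢
    field_simp
    ring
  · rw [if_neg hij, mul_zero]
    refine tendsto_const_nhds.congr' ?_
    filter_upwards [eventually_mem_Ioo] with ℓ hℓ
    rw [pairing_conv_eq_zero hG hD hφ hψ hℓ.1 hℓ.2 hij, zero_div]

lemma l2Norm_conv_biotSavart_sq {DG : Fin 2 → T2 → ℝ} (hD : ∀ i, Integrable (DG i) torusMeasure)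
    {θ : Plane → ℝ} (hθ : IsRadialDensity θ) (ℓ : ℝ) :
    l2Norm (conv (biotSavart DG) (rescale θ ℓ)) ^ 2 =
      pairing (conv (DG 0) (rescale θ ℓ)) (conv (DG 0) (rescale θ ℓ)) +
      pairing (conv (DG 1) (rescale θ ℓ)) (conv (DG 1) (rescale θ ℓ)) := by
  obtain ⟨M, -, hM⟩ := hθ.exists_abs_rescale_le
  have hint (i : Fin 2) (x : T2) :
      Integrable (fun t => rescale θ ℓ t * DG i (x - t)) torusMeasure :=
    ((hD i).comp_sub_left x).bdd_mul (c := (ℓ ^ 2)⁻¹ * M)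
      (hθ.measurable_rescale ℓ).aestronglyMeasurable (ae_of_all _ fun t => hM ℓ t)
  have hK (x : T2) : conv (biotSavart DG) (rescale θ ℓ) x =
      !₂[conv (DG 1) (rescale θ ℓ) x, -conv (DG 0) (rescale θ ℓ) x] := by
    have hi : Integrable (fun t => rescale θ ℓ t • biotSavart DG (x - t)) torusMeasure := by
      refine (PiLp.continuousLinearEquiv 2 ℝ fun _ : Fin 2 => ℝ).integrable_comp_iff.1 ?_
      refine Integrable.of_eval fun i => ?_
      fin_cases i
      · simpa [biotSavart] using hint 1 x
      · simpa [biotSavart] using (hint 0 x).neg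
    have hc (i : Fin 2) : conv (biotSavart DG) (rescale θ ℓ) x i =
        ∫ t, rescale θ ℓ t * biotSavart DG (x - t) i ∂torusMeasure := by
      have := (EuclideanSpace.proj (𝕜 := ℝ) i).integral_comp_comm hi
      simpa [conv, convolution_def] using this.symm
    ext i
    rw [hc]
    fin_cases i <;> simp [biotSavart, conv, convolution_def, integral_neg]
  have hsq (i : Fin 2) : Integrable (fun x => conv (DG i) (rescale θ ℓ) x *
      conv (DG i) (rescale θ ℓ) x) torusMeasure := by
    have := (memLp_conv (hD i) (hθ.integrable_rescale ℓ) (hM ℓ)).integrable_norm_pow (by norm_num)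
    simpa [sq_abs, ← pow_two] using this
  rw [l2Norm, Real.sq_sqrt (integral_nonneg fun x => by positivity), pairing, pairing,
    ← integral_add (hsq 0) (hsq 1)]
  refine integral_congr_ae (ae_of_all _ fun x => ?_)
  simp only [hK, EuclideanSpace.norm_sq_eq, Fin.sum_univ_two]
  simp
  ring

lemma tendsto_intensity_sq_mul_log {G : T2 → ℝ} {DG : Fin 2 → T2 → ℝ} (hG : IsGreenFunction G)
    (hD : ∀ i, IsWeakPartialDeriv i G (DG i)) {θ : Plane → ℝ} (hθ : IsRadialDensity θ) {κ : ℝ}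
    (hκ : 0 < κ) :
    Tendsto (fun ℓ : ℝ => intensity DG κ θ ℓ ^ 2 * Real.log ℓ⁻¹) (𝓝[>] 0)
      (𝓝 (8 * Real.pi * κ)) := by
  have h := (tendsto_pairing_div_log hG hD hθ hθ 0 0).add (tendsto_pairing_div_log hG hD hθ hθ 1 1)
  simp only [if_true, mul_one] at h
  -- The squared norm over the logarithm tends to `1/(2π)`, and `Γ_ℓ²` is `4κ` over the squared
  -- norm.
  have h2 := (h.inv₀ (by positivity)).const_mul (4 * κ)
  have e : 4 * κ * (1 / (4 * Real.pi) + 1 / (4 * Real.pi))⁻¹ = 8 * Real.pi * κ := by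
    field_simp; norm_num
  rw [e] at h2
  refine h2.congr fun ℓ => ?_
  rw [intensity, mul_pow, mul_pow, inv_pow, Real.sq_sqrt hκ.le,
    l2Norm_conv_biotSavart_sq (fun i => (hD i).integrable) hθ, ← add_div, inv_div]
  ring

end TorusVortex

end

theorem mainTheorem4 :
    (∃ (G : TorusVortex.T2 → ℝ) (DG : Fin 2 → TorusVortex.T2 → ℝ),
      TorusVortex.IsGreenFunction G ∧ ∀ i, TorusVortex.IsWeakPartialDeriv i G (DG i)) ∧
    ∀ (G : TorusVortex.T2 → ℝ) (DG : Fin 2 → TorusVortex.T2 → ℝ),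
      TorusVortex.IsGreenFunction G → (∀ i, TorusVortex.IsWeakPartialDeriv i G (DG i)) →
      (∀ φ ψ : TorusVortex.Plane → ℝ,
        TorusVortex.IsRadialDensity φ → TorusVortex.IsRadialDensity ψ → ∀ i j : Fin 2,
        Tendsto
          (fun ℓ : ℝ =>
            TorusVortex.pairing (TorusVortex.conv (DG i) (TorusVortex.rescale φ ℓ))
              (TorusVortex.conv (DG j) (TorusVortex.rescale ψ ℓ)) / Real.log ℓ⁻¹)
          (𝓝[>] 0) (𝓝 (1 / (4 * Real.pi) * if i = j then 1 else 0))) ∧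
      (∀ θ : TorusVortex.Plane → ℝ, TorusVortex.IsRadialDensity θ → ∀ κ : ℝ, 0 < κ →
        Tendsto (fun ℓ : ℝ => TorusVortex.intensity DG κ θ ℓ ^ 2 * Real.log ℓ⁻¹)
          (𝓝[>] 0) (𝓝 (8 * Real.pi * κ))) := by
  refine ⟨TorusVortex.exists_greenFunction_gradient, fun G DG hG hD => ⟨fun φ ψ hφ hψ i j => ?_,
    fun θ hθ κ hκ => ?_⟩⟩
  · exact TorusVortex.tendsto_pairing_div_log hG hD hφ hψ i j
  · exact TorusVortex.tendsto_intensity_sq_mul_log hG hD hθ hκ
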